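/- Let $n\ge 1$ be an integer, $\sigma_w,\sigma_v>0$, and let $a\in\mathbb{R}$ with $a>0$ if $n$ is odd and $a<0$ if $n$ is even. Consider on $L^2(\mathbb{R})$ (complex scalars, functions of $x$) the plant $$\frac{d\psi}{dt}=\mathcal{A}\psi+\sigma_w w,\qquad y=\psi+\sigma_v v,\qquad \mathcal{A}=a\,\partial_x^{2n},\quad \mathcal{D}(\mathcal{A})=H_{2n}(\mathbb{R}),$$ where $w,v$ are independent zero-mean Gaussian white noises with identity covariance operators and $H_{2n}(\mathbb{R})$ is the Sobolev space of functions whose distributional derivatives of order at most $2n$ lie in $L^2(\mathbb{R})$. Its steady-state Kalman gain is $\mathcal{L}=\sigma_v^{-2}\mathcal{P}$, where the error covariance $\mathcal{P}$ is a bounded non-negative self-adjoint operator solving the algebraic Riccati equation $$\langle \mathcal{P}h,\mathcal{A}^*f\rangle+\langle \mathcal{P}\mathcal{A}^*h,f\rangle+\sigma_w^2\langle h,f\rangle-\sigma_v^{-2}\langle \mathcal{P}^2h,f\rangle=0\qquad\text{for all } h,f\in\mathcal{D}(\mathcal{A}^*).$$ Then there is exactly one such operator $\mathcal{L}$; with the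 Fourier transform $\hat f(\lambda)=(2\pi)^{-1/2}\int_{\mathbb{R}} f(x)e^{-i\lambda x}\,dx$ it is the Fourier multiplier with the continuous symbol $$\hat{\mathcal{L}}_\lambda=-|a|\lambda^{2n}+\sqrt{a^2\lambda^{4n}+\sigma_w^2/\sigma_v^2},\qquad \lambda\in\mathbb{R}.$$ Let $\hat{\mathcal{L}}_z$ be the (multivalued) extension of this symbol to the complex plane obtained by replacing $\lambda$ by $-iz$, that is, the multivalued analytic function generated by analytic continuation from $\hat{\mathcal{L}}_z=\hat{\mathcal{L}}_{\lambda}$ at $z=i\lambda$, $\lambda\in\mathbb{R}$. A point $z_0\in\mathbb{C}$ is a (finite) branch point of it if some branch, near a point of a punctured disc around $z_0$, can be continued along every path in that punctured disc and does not return to itself along some loop in it. The asymptotic exponential spatial decay rate of $\mathcal{L}$ is $$\theta:=\min\{|\mathrm{Re}\,z_0| : z_0 \text{ is a finite branch point of } \hat{\mathcal{L}}_z\}.$$ This minimum exists, is positive, and equals $$\theta=\sin\Big(\frac{\pi}{4n}\Big)\Big(\frac{\sigma_w}{|a|\,\sigma_v}\Big)^{\frac{1}{2n}} .$$ -/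

import Mathlib

open MeasureTheory FourierTransform
open scoped SchwartzMap Topology

noncomputable section

/-! ### The plant -/

/-- The state space: square-integrable functions on the real line. -/
abbrev L2R : Type := Lp (α := ℝ) ℂ 2 volume

/-- `g` is the `k`-th distributional derivative of `f`. -/
def HasDistribDeriv (k : ℕ) (f g : L2R) : Prop :=
  (TemperedDistribution.derivCLM ℂ)^[k] (Lp.toTemperedDistribution f) =
    Lp.toTemperedDistribution g

lemma toTD_add (f g : L2R) : Lp.toTemperedDistribution (f + g) =
    Lp.toTemperedDistribution f + Lp.toTemperedDistribution g :=
  (Lp.toTemperedDistributionCLM ℂ (volume : Measure ℝ) 2).map_add f g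

lemma toTD_smul (c : ℂ) (f : L2R) : Lp.toTemperedDistribution (c • f) =
    c • Lp.toTemperedDistribution f :=
  (Lp.toTemperedDistributionCLM ℂ (volume : Measure ℝ) 2).map_smul c f

lemma HasDistribDeriv.add {k : ℕ} {f f' g g' : L2R} (h : HasDistribDeriv k f g)
    (h' : HasDistribDeriv k f' g') : HasDistribDeriv k (f + f') (g + g') := by
  unfold HasDistribDeriv at *
  rw [toTD_add, toTD_add, iterate_map_add, h, h']

lemma HasDistribDeriv.smul {k : ℕ} (c : ℂ) {f g : L2R} (h : HasDistribDeriv k f g) :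
    HasDistribDeriv k (c • f) (c • g) := by
  unfold HasDistribDeriv at *
  rw [toTD_smul, toTD_smul, ← h]
  exact (Function.Commute.iterate_left
    (f := TemperedDistribution.derivCLM ℂ) (g := fun u => c • u)
    (fun u => (TemperedDistribution.derivCLM ℂ).map_smul c u) k) _

lemma HasDistribDeriv.unique {k : ℕ} {f g g' : L2R} (h : HasDistribDeriv k f g)
    (h' : HasDistribDeriv k f g') : g = g' := by
  have := h.symm.trans h'
  exact LinearMap.ker_eq_bot.1
    (Lp.ker_toTemperedDistributionCLM_eq_bot (F := ℂ) (μ := (volume : Measure ℝ)) (p := 2)) this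

/-- The Sobolev space of order `k`: all distributional derivatives of order at most `k` are
square-integrable. -/
def sobolevSpace (k : ℕ) : Submodule ℂ L2R where
  carrier := {f | ∀ j ≤ k, ∃ g, HasDistribDeriv j f g}
  add_mem' := fun hf hf' j hj => by
    obtain ⟨g, hg⟩ := hf j hj
    obtain ⟨g', hg'⟩ := hf' j hj
    exact ⟨_, hg.add hg'⟩
  zero_mem' := fun j _ => ⟨(0 : ℂ) • 0, by
    simpa using HasDistribDeriv.smul (k := j) (0 : ℂ) (f := 0) (g := 0) (by
      have h0 : Lp.toTemperedDistribution (0 : L2R) = 0 :=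
        (Lp.toTemperedDistributionCLM ℂ (volume : Measure ℝ) 2).map_zero
      unfold HasDistribDeriv
      rw [h0, iterate_map_zero])⟩
  smul_mem' := fun c f hf j hj => by
    obtain ⟨g, hg⟩ := hf j hj
    exact ⟨_, hg.smul c⟩

/-- The operator `∂_x^k` on `L²(ℝ)` with domain the Sobolev space of order `k`. -/
def derivOp (k : ℕ) : L2R →ₗ.[ℂ] L2R where
  domain := sobolevSpace k
  toFun :=
    { toFun := fun f => (f.2 k le_rfl).choose
      map_add' := fun f f' => HasDistribDeriv.unique ((f + f').2 k le_rfl).choose_spec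
        ((f.2 k le_rfl).choose_spec.add (f'.2 k le_rfl).choose_spec)
      map_smul' := fun c f => HasDistribDeriv.unique ((c • f).2 k le_rfl).choose_spec
        ((f.2 k le_rfl).choose_spec.smul c) }

/-- A linear plant `dψ/dt = 𝒜 ψ + ℬ w`, `y = 𝒞 ψ + 𝒢 v`, where `w` and `v` are independent
white noises with identity covariance operators (so that `ℬ ℬ*` and `𝒢 𝒢*` are the covariance
operators of the process and the measurement noise). -/
structure Plant where
  A : L2R →ₗ.[ℂ] L2R
  B : L2R →L[ℂ] L2R
  C : L2R →L[ℂ] L2R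
  G : L2R →L[ℂ] L2R

/-- The plant `dψ/dt = a ∂_x^{2n} ψ + σ_w w`, `y = ψ + σ_v v`. -/
def monomialPlant (n : ℕ) (a σw σv : ℝ) : Plant where
  A := (a : ℂ) • derivOp (2 * n)
  B := (σw : ℂ) • ContinuousLinearMap.id ℂ L2R
  C := ContinuousLinearMap.id ℂ L2R
  G := (σv : ℂ) • ContinuousLinearMap.id ℂ L2R

/-! ### The Kalman gain -/

/-- `(𝒢 𝒢*)⁻¹`. -/
def Plant.noiseInv (S : Plant) : L2R →L[ℂ] L2R :=
  Ring.inverse (S.G * ContinuousLinearMap.adjoint S.G)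

/-- `P` is a bounded non-negative self-adjoint solution of the operator algebraic Riccati equation
`⟨(𝒜 P + P 𝒜* + ℬ ℬ* - P 𝒞* (𝒢 𝒢*)⁻¹ 𝒞 P) h, f⟩ = 0` for all `h, f ∈ 𝒟(𝒜*)`,
where `⟨𝒜 P h, f⟩` is read as `⟨P h, 𝒜* f⟩`. (When the plant is exponentially stabilizable and
detectable, this non-negative solution is unique and it is the stabilizing one.)
(The inner product `inner ℂ f u` is conjugate-linear in `f`, i.e. it is `∫ u f*`.) -/
def Plant.IsErrorCovariance (S : Plant) (P : L2R →L[ℂ] L2R) : Prop :=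
  P.IsPositive ∧ ∀ h f : S.A.adjoint.domain,
    inner ℂ (S.A.adjoint f) (P h) + inner ℂ (f : L2R) (P (S.A.adjoint h))
      + inner ℂ (f : L2R) (S.B (ContinuousLinearMap.adjoint S.B h))
      - inner ℂ (f : L2R)
          (P (ContinuousLinearMap.adjoint S.C (S.noiseInv (S.C (P h))))) = 0

/-- `L = P 𝒞* (𝒢 𝒢*)⁻¹`, with `P` the steady-state covariance of the optimal estimation error. -/
def Plant.IsKalmanGain (S : Plant) (L : L2R →L[ℂ] L2R) : Prop :=
  ∃ P, S.IsErrorCovariance P ∧ L = P * ContinuousLinearMap.adjoint S.C * S.noiseInv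

/-- `ℓ` is the continuous Fourier symbol of `L`: with the transform
`ĥ(lam) = (2π)^(-1/2) ∫ h(x) exp(-i lam x) dx`, one has `(L h)^(lam) = ℓ(lam) ĥ(lam)`.
In terms of Mathlib's transform, `ĥ(lam) = (2π)^(-1/2) (𝓕 h)(lam / 2π)`. -/
def IsFourierSymbol (L : L2R →L[ℂ] L2R) (ℓ : ℝ → ℂ) : Prop :=
  Continuous ℓ ∧ ∀ h : L2R,
    ((𝓕 (L h) : L2R) : ℝ → ℂ) =ᵐ[volume]
      fun ξ => ℓ (2 * Real.pi * ξ) * ((𝓕 h : L2R) : ℝ → ℂ) ξ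

/-! ### Analytic continuation and branch points -/

/-- `F t`, `t ∈ [0,1]`, is an analytic continuation along the path `γ`: each `F t` is analytic at
`γ t`, and for `s` close to `t` the germ of `F s` at `γ s` is that of `F t`. -/
def IsContinuationAlong {p q : ℂ} (γ : Path p q) (F : unitInterval → ℂ → ℂ) : Prop :=
  ∀ t, AnalyticAt ℂ (F t) (γ t) ∧ ∀ᶠ s in 𝓝 t, F s =ᶠ[𝓝 (γ s)] F t

/-- Analytic continuation along `γ` takes the germ of `f` at `p` to the germ of `g` at `q`. -/
def ContinuesTo {p q : ℂ} (γ : Path p q) (f g : ℂ → ℂ) : Prop :=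
  ∃ F, IsContinuationAlong γ F ∧ F 0 =ᶠ[𝓝 p] f ∧ F 1 =ᶠ[𝓝 q] g

/-- `z₀` is a (finite) branch point of the multivalued analytic function generated by the germ of
`f` at `p`: some branch of it, at a point of a punctured disc around `z₀`, continues along every
path in that punctured disc, and comes back different along some loop in it. -/
def IsBranchPoint (f : ℂ → ℂ) (p z₀ : ℂ) : Prop :=
  ∃ r > 0, ∃ q ∈ Metric.ball z₀ r \ {z₀}, ∃ g : ℂ → ℂ,
    (∃ γ : Path p q, ContinuesTo γ f g) ∧
    (∀ (q' : ℂ) (γ : Path q q'), (∀ t, γ t ∈ Metric.ball z₀ r \ {z₀}) →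
      ∃ g', ContinuesTo γ g g') ∧
    ∃ γ : Path q q, (∀ t, γ t ∈ Metric.ball z₀ r \ {z₀}) ∧
      ∃ g', ContinuesTo γ g g' ∧ ¬ g' =ᶠ[𝓝 q] g

/-- The germ of `f` at `i lam₀` is the extension of the symbol `ℓ`, obtained by putting `-i z` in
place of the real variable: `f(z) = ℓ(-i z)` for `z = i lam` with `lam` real and close to `lam₀`. -/
def IsExtensionGerm (ℓ : ℝ → ℂ) (lam₀ : ℝ) (f : ℂ → ℂ) : Prop :=
  AnalyticAt ℂ f (Complex.I * lam₀) ∧ ∀ᶠ lam : ℝ in 𝓝 lam₀, f (Complex.I * lam) = ℓ lam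

/-- The branch points of the (multivalued) extension of the symbol `ℓ` to the complex plane. -/
def extensionBranchPoints (ℓ : ℝ → ℂ) : Set ℂ :=
  {z₀ | ∃ lam₀ f, IsExtensionGerm ℓ lam₀ f ∧ IsBranchPoint f (Complex.I * lam₀) z₀}

/-- `θ` is the asymptotic spatial decay rate of the spatially invariant operator `L`: the least
`|Re z|` over the branch points `z` of the extension of its symbol, and positive. -/
def HasDecayRate (L : L2R →L[ℂ] L2R) (θ : ℝ) : Prop :=
  0 < θ ∧ ∃ ℓ, IsFourierSymbol L ℓ ∧
    IsLeast ((fun z : ℂ => |z.re|) '' extensionBranchPoints ℓ) θ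

end

/-! The Fourier transform makes the problem scalar. The sign condition on `a` turns `𝒜` into
multiplication by `-m`, with `m ξ = |a| (2πξ)^(2n) ≥ 0`, on its maximal domain; so `𝒜` is
self-adjoint and dissipative. With `c = σv⁻²` and `s = σw²`, the non-negative root `p` of `-2 m p +
s - c p² = 0` is the symbol of a bounded solution `P`, and `c p` is the symbol of the gain.

Uniqueness has to exclude solutions that are not assumed to be multipliers (`riccati_unique`). For
another non-negative solution `P'` and `Q = P' - P`, subtracting the equations gives `Q (cP - A) =
-(cP' - A) Q`. Since `cP' - A` is accretive, `‖Q e^{-t(cP - A)} g‖` is nondecreasing in `t`, while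
`e^{-t(cP - A)} g` tends to 0; hence `Q = 0`. The proof runs this argument with powers of the Cayley
transform of `cP - A` in place of the semigroup (`eq_riccatiOp`).

For the decay rate, every germ `f` extending the symbol satisfies `(f - k)² = R` with `k` a
polynomial and `R z = a² z^(4n) + (σw/σv)²`, whose zeros are simple. Branch points are zeros of `R`
(`IsBranchPoint.radicand_eq_zero`), and a simple zero reached from the base point along a segment
free of other zeros is a branch point (`isBranchPoint_of_simple_zero`). The zeros lie on a circle
about 0, at the odd multiples of the angle `π/(4n)`; the closest ones to the imaginary axis make
that angle with it, which produces the sine. -/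

noncomputable section

/-! ### Self-adjointness and uniqueness for the Riccati equation in a Hilbert space. -/

section Abstract

/-- The squared norms differ by `4 Re ⟨v, x⟩`. This converts dissipativity into a norm inequality
for the Cayley transform. -/
lemma norm_add_le_norm_sub_of_re_inner_nonpos {E : Type*} [NormedAddCommGroup E]
    [InnerProductSpace ℂ E] {v x : E} (h : (inner ℂ v x).re ≤ 0) :
    ‖v + x‖ ≤ ‖v - x‖ := by
  have h1 := @norm_add_sq ℂ E _ _ _ v x
  have h2 := @norm_sub_sq ℂ E _ _ _ v x
  refine le_of_sq_le_sq ?_ (norm_nonneg _)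
  change (RCLike.re (inner ℂ v x)) ≤ 0 at h
  linarith

variable {H : Type*} [NormedAddCommGroup H] [InnerProductSpace ℂ H] [CompleteSpace H]

open LinearPMap in
/-- A symmetric-resolvent criterion: if the graph of `A` is `{(x, y) | x = R (x - y)}` for a bounded
self-adjoint `R` (so that `R = (1 - A)⁻¹`), then `A` is self-adjoint. -/
theorem adjoint_eq_self_of_resolvent {A : H →ₗ.[ℂ] H} {R : H →L[ℂ] H} (hR : IsSelfAdjoint R)
    (hA : ∀ x y, (∃ hx : x ∈ A.domain, A ⟨x, hx⟩ = y) ↔ x = R (x - y)) : A.adjoint = A := by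
  have hsym : ∀ x y, inner ℂ (R x) y = inner ℂ x (R y) := fun x y => by
    rw [← ContinuousLinearMap.adjoint_inner_right, hR.adjoint_eq]
  have hRk : ∀ k, ∃ hx : R k ∈ A.domain, A ⟨R k, hx⟩ = R k - k := fun k =>
    (hA _ _).2 (by simp)
  have hinj : ∀ y, R y = 0 → y = 0 := fun y hy => by
    obtain ⟨hx, h⟩ := (hA 0 y).2 (by simp [hy])
    rw [← h]
    exact A.toFun.map_zero
  -- A vector orthogonal to the domain is orthogonal to the range of `R`, hence killed by `R`, which
  -- is injective.
  have hdense : Dense (A.domain : Set H) := by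
    rw [Submodule.dense_iff_topologicalClosure_eq_top, Submodule.topologicalClosure_eq_top_iff,
      Submodule.eq_bot_iff]
    intro x hx
    apply hinj
    refine ext_inner_right ℂ fun k => ?_
    rw [hsym, inner_zero_left]
    exact Submodule.inner_left_of_mem_orthogonal (hRk k).1 hx
  -- The graph of the adjoint has the same description through `R` as that of `A`, so the two
  -- coincide.
  have hchar : ∀ x y, (∃ hx : x ∈ A.adjoint.domain, A.adjoint ⟨x, hx⟩ = y) ↔ x = R (x - y) := by
    intro x y
    constructor
    · rintro ⟨hx, rfl⟩
      refine ext_inner_right ℂ fun k => ?_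
      obtain ⟨hk, hAk⟩ := hRk k
      have := A.adjoint_isFormalAdjoint hdense ⟨x, hx⟩ ⟨R k, hk⟩
      rw [hAk] at this
      simp only [inner_sub_right] at this
      rw [hsym, inner_sub_left, this]
      ring
    · intro h
      have key : ∀ z : A.domain, inner ℂ y (z : H) = inner ℂ x (A z) := fun z => by
        have hz := (hA z (A z)).1 ⟨z.2, rfl⟩
        have h1 : inner ℂ x ((z : H) - A z) = inner ℂ (x - y) (z : H) := by
          conv_lhs => rw [h]
          rw [hsym, ← hz]
        simp only [inner_sub_right, inner_sub_left] at h1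
        exact (sub_right_injective h1).symm
      refine ⟨mem_adjoint_domain_of_exists _ ⟨y, key⟩, adjoint_apply_eq hdense _ key⟩
  refine LinearPMap.ext ?_ ?_
  · ext x
    constructor
    · intro hx
      exact ((hA _ _).2 ((hchar _ _).1 ⟨hx, rfl⟩)).1
    · intro hx
      exact ((hchar _ _).2 ((hA _ _).1 ⟨hx, rfl⟩)).1
  · intro x hx hx'
    obtain ⟨_, h⟩ := (hA _ _).2 ((hchar _ _).1 ⟨hx, rfl⟩)
    exact h.symm

/-- Weak solutions of `A x = y` are strong when `A` is self-adjoint. This will put `Q h` in the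
domain, which a solution of the Riccati equation is not assumed to preserve. -/
lemma exists_apply_eq_of_adjoint_eq {A : H →ₗ.[ℂ] H} (hA : A.adjoint = A) {x y : H}
    (h : ∀ z : A.domain, inner ℂ y (z : H) = inner ℂ x (A z)) :
    ∃ hx : x ∈ A.domain, A ⟨x, hx⟩ = y := by
  have hd : Dense (A.domain : Set H) :=
    IsSelfAdjoint.dense_domain (LinearPMap.isSelfAdjoint_def.2 hA)
  have : ∃ hx : x ∈ A.adjoint.domain, A.adjoint ⟨x, hx⟩ = y :=
    ⟨LinearPMap.mem_adjoint_domain_of_exists _ ⟨y, h⟩, LinearPMap.adjoint_apply_eq hd _ h⟩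
  rwa [hA] at this

/-- The sesquilinear form of the algebraic Riccati equation with scalar noise intensities. -/
def riccatiForm (A : H →ₗ.[ℂ] H) (P : H →L[ℂ] H) (c s : ℂ) (h f : A.domain) : ℂ :=
  inner ℂ (A f) (P h) + inner ℂ (f : H) (P (A h)) + inner ℂ (f : H) (s • (h : H))
    - inner ℂ (f : H) (c • P (P h))

/-- Uniqueness of the non-negative solution of the algebraic Riccati equation of a dissipative
self-adjoint `A`, given one solution `P` for which the Cayley transform `C` of the closed loop
`-A + c P` is strongly stable. -/
theorem riccati_unique {A : H →ₗ.[ℂ] H} (hA : A.adjoint = A)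
    (hdiss : ∀ v : A.domain, (inner ℂ (v : H) (A v)).re ≤ 0) {c : ℝ} (hc : 0 ≤ c) {s : ℂ}
    {P P' C : H →L[ℂ] H} (hP' : P'.IsPositive)
    (hric : ∀ h f, riccatiForm A P c s h f = 0) (hric' : ∀ h f, riccatiForm A P' c s h f = 0)
    (hC : ∀ g, ∃ h : A.domain, (h : H) + ((c : ℂ) • P h - A h) = g ∧
      (h : H) - ((c : ℂ) • P h - A h) = C g)
    (hC0 : ∀ g, Filter.Tendsto (fun k : ℕ => (C ^ k) g) Filter.atTop (𝓝 0)) : P' = P := by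
  set Q := P' - P with hQ
  -- The intertwining relation `(A - cP') Q = Q (cP - A)`, from the difference of the two Riccati
  -- equations.
  have step : ∀ h : A.domain, ∃ hq : Q h ∈ A.domain,
      A ⟨Q h, hq⟩ - (c : ℂ) • P' (Q h) = Q ((c : ℂ) • P h - A h) := by
    intro h
    have key : ∀ z : A.domain,
        inner ℂ ((c : ℂ) • P' (P' h) - (c : ℂ) • P (P h) - Q (A h)) (z : H)
          = inner ℂ (Q h) (A z) := by
      intro z
      have e1 := hric h z
      have e2 := hric' h z
      unfold riccatiForm at e1 e2
      rw [← inner_conj_symm, ← inner_conj_symm (Q h)]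
      congr 1
      simp only [hQ, sub_apply, inner_sub_right]
      linear_combination e1 - e2
    obtain ⟨hq, hval⟩ := exists_apply_eq_of_adjoint_eq hA key
    refine ⟨hq, ?_⟩
    rw [hval]
    simp only [hQ, sub_apply, map_sub, map_smul, smul_sub]
    abel
  -- With `v = Q h` and `x = (A - cP') v`, intertwining gives `Q g = v + x` and `Q (C g) = v - x`,
  -- where `Re ⟨v, x⟩ ≤ 0`.
  have contr : ∀ g, ‖Q g‖ ≤ ‖Q (C g)‖ := by
    intro g
    obtain ⟨h, h1, h2⟩ := hC g
    obtain ⟨hq, h3⟩ := step h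
    rw [← h2, ← h1, Q.map_add (h : H), Q.map_sub (h : H), ← h3]
    apply norm_add_le_norm_sub_of_re_inner_nonpos
    rw [inner_sub_right, inner_smul_right, Complex.sub_re, Complex.re_ofReal_mul]
    have d1 := hdiss ⟨Q h, hq⟩
    have d2 := hP'.re_inner_nonneg_right (Q h)
    have := mul_nonneg hc d2
    change 0 ≤ c * (inner ℂ (Q h) (P' (Q h))).re at this
    linarith
  have hpow : ∀ g (k : ℕ), ‖Q g‖ ≤ ‖Q ((C ^ k) g)‖ := by
    intro g k
    induction k with
    | zero => simp
    | succ k ih =>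
      refine ih.trans ((contr _).trans_eq ?_)
      rw [pow_succ']
      rfl
  have hQ0 : Q = 0 := by
    ext g
    have ht : Filter.Tendsto (fun k : ℕ => ‖Q ((C ^ k) g)‖) Filter.atTop (𝓝 0) := by
      have := ((Q.continuous.norm).tendsto 0).comp (hC0 g)
      simpa [Function.comp_def] using this
    have := ge_of_tendsto' ht (hpow g)
    simpa using this
  exact sub_eq_zero.1 hQ0

end Abstract

/-! ### Fourier multipliers on `L²(ℝ)`. -/

section Multipliers

/-- `g` arises from `f` by multiplication with `b` in the Fourier domain. -/
def IsMult (b : ℝ → ℂ) (f g : L2R) : Prop :=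
  ((𝓕 g : L2R) : ℝ → ℂ) =ᵐ[volume] fun ξ => b ξ * ((𝓕 f : L2R) : ℝ → ℂ) ξ

lemma L2R.fourier_add (f g : L2R) : 𝓕 (f + g) = 𝓕 f + 𝓕 g :=
  (Lp.fourierTransformₗᵢ ℝ ℂ).map_add f g

lemma L2R.fourier_sub (f g : L2R) : 𝓕 (f - g) = 𝓕 f - 𝓕 g :=
  (Lp.fourierTransformₗᵢ ℝ ℂ).map_sub f g

lemma L2R.fourier_smul (c : ℂ) (f : L2R) : 𝓕 (c • f) = c • 𝓕 f :=
  (Lp.fourierTransformₗᵢ ℝ ℂ).map_smul c f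

lemma L2R.fourier_injective {f g : L2R} (h : 𝓕 f = 𝓕 g) : f = g :=
  (Lp.fourierTransformₗᵢ ℝ ℂ).injective h

namespace IsMult

variable {b b' : ℝ → ℂ} {f g g' u : L2R}

lemma unique (h : IsMult b f g) (h' : IsMult b f g') : g = g' :=
  L2R.fourier_injective (Lp.ext (h.trans h'.symm))

lemma congr (h : IsMult b f g) (hb : ∀ ξ, b ξ = b' ξ) : IsMult b' f g := by
  rwa [← funext hb]

lemma one (f : L2R) : IsMult (fun _ => 1) f f := by simp [IsMult]

lemma comp (h : IsMult b f g) (h' : IsMult b' g u) : IsMult (fun ξ => b' ξ * b ξ) f u := by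
  unfold IsMult at *
  filter_upwards [h, h'] with ξ h1 h2
  rw [h2, h1, mul_assoc]

lemma add (h : IsMult b f g) (h' : IsMult b' f u) : IsMult (fun ξ => b ξ + b' ξ) f (g + u) := by
  unfold IsMult at *
  rw [L2R.fourier_add]
  filter_upwards [h, h', Lp.coeFn_add (𝓕 g : L2R) (𝓕 u : L2R)] with ξ h1 h2 h3
  rw [h3, Pi.add_apply, h1, h2, add_mul]

lemma sub (h : IsMult b f g) (h' : IsMult b' f u) : IsMult (fun ξ => b ξ - b' ξ) f (g - u) := by
  unfold IsMult at *
  rw [L2R.fourier_sub]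
  filter_upwards [h, h', Lp.coeFn_sub (𝓕 g : L2R) (𝓕 u : L2R)] with ξ h1 h2 h3
  rw [h3, Pi.sub_apply, h1, h2, sub_mul]

lemma smul (c : ℂ) (h : IsMult b f g) : IsMult (fun ξ => c * b ξ) f (c • g) := by
  unfold IsMult at *
  rw [L2R.fourier_smul]
  filter_upwards [h, Lp.coeFn_smul c (𝓕 g : L2R)] with ξ h1 h3
  rw [h3, Pi.smul_apply, h1, smul_eq_mul, mul_assoc]

lemma inner_eq (h : IsMult b f g) (u : L2R) : inner ℂ u g =
    ∫ ξ, b ξ * (((𝓕 f : L2R) : ℝ → ℂ) ξ * star (((𝓕 u : L2R) : ℝ → ℂ) ξ)) := by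
  rw [← Lp.inner_fourier_eq, L2.inner_def]
  refine integral_congr_ae ?_
  unfold IsMult at h
  filter_upwards [h] with ξ h1
  rw [h1, RCLike.inner_apply, mul_assoc]
  rfl

/-- The quadratic form of a real multiplier. -/
lemma re_inner_eq {m : ℝ → ℝ} (h : IsMult (fun ξ => (m ξ : ℂ)) f g) :
    (inner ℂ f g).re = ∫ ξ, m ξ * ‖((𝓕 f : L2R) : ℝ → ℂ) ξ‖ ^ 2 := by
  rw [h.inner_eq f]
  have : ∀ ξ, (m ξ : ℂ) * (((𝓕 f : L2R) : ℝ → ℂ) ξ * star (((𝓕 f : L2R) : ℝ → ℂ) ξ))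
      = ((m ξ * ‖((𝓕 f : L2R) : ℝ → ℂ) ξ‖ ^ 2 : ℝ) : ℂ) := fun ξ => by
    rw [Complex.star_def, Complex.mul_conj']
    push_cast
    rfl
  simp_rw [this]
  rw [integral_complex_ofReal, Complex.ofReal_re]

lemma norm_sq_eq (h : IsMult b f g) :
    ‖g‖ ^ 2 = ∫ ξ, ‖b ξ‖ ^ 2 * ‖((𝓕 f : L2R) : ℝ → ℂ) ξ‖ ^ 2 := by
  have h1 := (IsMult.one g).congr (b' := fun _ => ((1 : ℝ) : ℂ)) (by simp)
  have h2 := h1.re_inner_eq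
  rw [← inner_self_eq_norm_sq (𝕜 := ℂ)]
  refine h2.trans (integral_congr_ae ?_)
  unfold IsMult at h
  filter_upwards [h] with ξ h3
  rw [h3, norm_mul, mul_pow, one_mul]

end IsMult

/-- The bounded operator with a given essentially bounded Fourier multiplier. -/
def multOp (b : ℝ → ℂ) (hb : MemLp b ⊤ volume) : L2R →L[ℂ] L2R :=
  ((Lp.fourierTransformₗᵢ ℝ ℂ).symm.toContinuousLinearEquiv : L2R →L[ℂ] L2R) ∘L
    ((ContinuousLinearMap.lsmul ℂ ℂ).holderL volume ⊤ 2 2 (hb.toLp b)) ∘L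
    ((Lp.fourierTransformₗᵢ ℝ ℂ).toContinuousLinearEquiv : L2R →L[ℂ] L2R)

lemma isMult_multOp {b : ℝ → ℂ} (hb : MemLp b ⊤ volume) (f : L2R) :
    IsMult b f (multOp b hb f) := by
  have h1 : 𝓕 (multOp b hb f) =
      (ContinuousLinearMap.lsmul ℂ ℂ).holderL volume ⊤ 2 2 (hb.toLp b) (𝓕 f : L2R) :=
    (Lp.fourierTransformₗᵢ ℝ ℂ).apply_symm_apply _
  unfold IsMult
  rw [h1]
  filter_upwards [(ContinuousLinearMap.lsmul ℂ ℂ).coeFn_holder (r := 2) (hb.toLp b) (𝓕 f : L2R),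
    hb.coeFn_toLp] with ξ h2 h3
  refine h2.trans ?_
  rw [h3]
  rfl

lemma isSelfAdjoint_multOp {m : ℝ → ℝ} (hb : MemLp (fun ξ => (m ξ : ℂ)) ⊤ volume) :
    IsSelfAdjoint (multOp _ hb) := by
  rw [ContinuousLinearMap.isSelfAdjoint_iff_isSymmetric]
  intro f g
  change inner ℂ (multOp _ hb f) g = inner ℂ f (multOp _ hb g)
  rw [← inner_conj_symm, (isMult_multOp hb f).inner_eq, (isMult_multOp hb g).inner_eq,
    ← integral_conj]
  congr 1
  ext ξ
  simp only [map_mul, Complex.conj_ofReal, Complex.star_def, Complex.conj_conj]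
  ring

lemma isPositive_multOp {m : ℝ → ℝ} (hb : MemLp (fun ξ => (m ξ : ℂ)) ⊤ volume)
    (hm : ∀ ξ, 0 ≤ m ξ) : (multOp _ hb).IsPositive := by
  refine ⟨ContinuousLinearMap.isSelfAdjoint_iff_isSymmetric.1 (isSelfAdjoint_multOp hb),
    fun f => ?_⟩
  change 0 ≤ RCLike.re (inner ℂ (multOp _ hb f) f)
  rw [inner_re_symm]
  change 0 ≤ (inner ℂ f (multOp _ hb f)).re
  rw [(isMult_multOp hb f).re_inner_eq]
  exact integral_nonneg fun ξ => mul_nonneg (hm ξ) (by positivity)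

/-- Powers of a multiplier of modulus less than one tend strongly to zero. -/
lemma tendsto_multOp_pow {b : ℝ → ℂ} (hb : MemLp b ⊤ volume) (h1 : ∀ ξ, ‖b ξ‖ < 1) (f : L2R) :
    Filter.Tendsto (fun k : ℕ => (multOp b hb ^ k) f) Filter.atTop (𝓝 0) := by
  have hk : ∀ k : ℕ, IsMult (fun ξ => b ξ ^ k) f ((multOp b hb ^ k) f) := by
    intro k
    induction k with
    | zero => simpa using IsMult.one f
    | succ k ih =>
      rw [pow_succ']
      exact (ih.comp (isMult_multOp hb _)).congr fun ξ => by rw [pow_succ']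
  have hlim : Filter.Tendsto (fun k : ℕ => ‖(multOp b hb ^ k) f‖ ^ 2) Filter.atTop (𝓝 0) := by
    simp_rw [fun k => (hk k).norm_sq_eq]
    have h0 : (∫ _ : ℝ, (0 : ℝ)) = 0 := by simp
    rw [← h0]
    have hmeas : AEStronglyMeasurable (fun ξ => ‖((𝓕 f : L2R) : ℝ → ℂ) ξ‖ ^ 2) volume :=
      (Lp.aestronglyMeasurable (𝓕 f : L2R)).norm.pow 2
    -- A pointwise bound is enough for strong convergence. For the Cayley symbol of the plant with
    -- `n ≥ 1`, the modulus tends to 1 at infinity, so the powers do not converge in norm.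
    refine tendsto_integral_of_dominated_convergence
      (fun ξ => ‖((𝓕 f : L2R) : ℝ → ℂ) ξ‖ ^ 2) (fun k => ?_) ?_ (fun k => ?_) ?_
    · exact ((hb.1.pow k).norm.pow 2).mul hmeas
    · exact (memLp_two_iff_integrable_sq_norm (Lp.aestronglyMeasurable _)).1 (Lp.memLp _)
    · refine Filter.Eventually.of_forall fun ξ => ?_
      rw [Real.norm_of_nonneg (by positivity)]
      refine mul_le_of_le_one_left (by positivity) ?_
      rw [norm_pow]
      exact pow_le_one₀ (by positivity) (pow_le_one₀ (norm_nonneg _) (h1 ξ).le)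
    · refine Filter.Eventually.of_forall fun ξ => ?_
      have := ((tendsto_pow_atTop_nhds_zero_of_lt_one (norm_nonneg _) (h1 ξ)).pow 2).mul_const
        (‖((𝓕 f : L2R) : ℝ → ℂ) ξ‖ ^ 2)
      simpa [norm_pow] using this
  rw [tendsto_zero_iff_norm_tendsto_zero]
  have := hlim.sqrt
  simpa [Real.sqrt_sq] using this

end Multipliers

/-! ### Distributional derivatives and Sobolev spaces on the Fourier side. -/

section Derivatives

lemma hasTemperateGrowth_two_pi_I_mul_pow (k : ℕ) :
    (fun ξ : ℝ => ((2 * Real.pi * Complex.I) * (ξ : ℂ)) ^ k).HasTemperateGrowth := by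
  have h : (fun ξ : ℝ => (2 * Real.pi * Complex.I) * (ξ : ℂ)).HasTemperateGrowth := by fun_prop
  exact h.pow k

lemma fourier_derivCLM (u : 𝓢'(ℝ, ℂ)) : 𝓕 (TemperedDistribution.derivCLM ℂ u) =
    TemperedDistribution.smulLeftCLM ℂ (fun ξ : ℝ => (2 * Real.pi * Complex.I) * (ξ : ℂ)) (𝓕 u) := by
  have h1 : TemperedDistribution.derivCLM ℂ u = LineDeriv.lineDerivOp (1 : ℝ) u := by
    ext g
    rw [TemperedDistribution.derivCLM_apply_apply, TemperedDistribution.lineDerivOp_apply_apply]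
    congr 2
  rw [h1, TemperedDistribution.fourier_lineDerivOp_eq]
  have h2 : (fun ξ : ℝ => (2 * Real.pi * Complex.I) * (ξ : ℂ)) =
      (2 * Real.pi * Complex.I) • fun ξ : ℝ => ((inner ℝ ξ (1 : ℝ) : ℝ) : ℂ) := by
    ext ξ
    simp
  rw [h2, TemperedDistribution.smulLeftCLM_smul (by fun_prop)]
  rfl

lemma fourier_derivCLM_iterate (k : ℕ) (u : 𝓢'(ℝ, ℂ)) :
    𝓕 ((TemperedDistribution.derivCLM ℂ)^[k] u) =
      TemperedDistribution.smulLeftCLM ℂ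
        (fun ξ : ℝ => ((2 * Real.pi * Complex.I) * (ξ : ℂ)) ^ k) (𝓕 u) := by
  induction k with
  | zero => simp
  | succ k ih =>
    have h1 := hasTemperateGrowth_two_pi_I_mul_pow 1
    simp only [pow_one] at h1
    rw [Function.iterate_succ_apply', fourier_derivCLM, ih,
      TemperedDistribution.smulLeftCLM_smulLeftCLM_apply (hasTemperateGrowth_two_pi_I_mul_pow k) h1]
    simp only [pow_succ]
    rfl

/-- Smooth compactly supported functions are Schwartz, and they already separate locally integrable
functions up to null sets. -/
lemma toTemperedDistribution_eq_smulLeftCLM_iff {w : ℝ → ℂ} (hw : w.HasTemperateGrowth)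
    (f g : L2R) :
    TemperedDistribution.smulLeftCLM ℂ w (Lp.toTemperedDistribution f) =
      Lp.toTemperedDistribution g ↔ (g : ℝ → ℂ) =ᵐ[volume] fun ξ => w ξ * (f : ℝ → ℂ) ξ := by
  have hint : ∀ φ : 𝓢(ℝ, ℂ), TemperedDistribution.smulLeftCLM ℂ w
      (Lp.toTemperedDistribution f) φ = ∫ ξ, φ ξ • (w ξ * (f : ℝ → ℂ) ξ) := fun φ => by
    rw [TemperedDistribution.smulLeftCLM_apply_apply, Lp.toTemperedDistribution_apply]
    congr 1
    ext ξ
    rw [SchwartzMap.smulLeftCLM_apply_apply hw]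
    simp only [smul_eq_mul]
    ring
  constructor
  · intro h
    have hcont : Continuous w := hw.1.continuous
    have hf : LocallyIntegrable (f : ℝ → ℂ) volume := (Lp.memLp f).locallyIntegrable (by norm_num)
    have hg : LocallyIntegrable (g : ℝ → ℂ) volume := (Lp.memLp g).locallyIntegrable (by norm_num)
    have hwf : LocallyIntegrable (fun ξ => w ξ * (f : ℝ → ℂ) ξ) volume := by
      rw [← locallyIntegrableOn_univ] at hf ⊢
      exact hf.continuousOn_mul hcont.continuousOn isClosed_univ.isLocallyClosed
    refine ae_eq_of_integral_contDiff_smul_eq hg hwf fun φ hφ hφc => ?_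
    have h1 : HasCompactSupport (Complex.ofRealCLM ∘ φ) := hφc.comp_left rfl
    have h2 : ContDiff ℝ (⊤ : ℕ∞) (Complex.ofRealCLM ∘ φ) := by fun_prop
    have h3 := congrArg (fun u : 𝓢'(ℝ, ℂ) => u (h1.toSchwartzMap h2)) h
    simp only [hint, Lp.toTemperedDistribution_apply] at h3
    simpa using h3.symm
  · intro h
    ext φ
    rw [hint, Lp.toTemperedDistribution_apply]
    refine integral_congr_ae ?_
    filter_upwards [h] with ξ hξ
    rw [hξ]

/-- Distributional derivatives of square-integrable functions on the Fourier side. -/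
theorem hasDistribDeriv_iff (k : ℕ) (f g : L2R) :
    HasDistribDeriv k f g ↔
      IsMult (fun ξ => ((2 * Real.pi * Complex.I) * (ξ : ℂ)) ^ k) f g := by
  unfold HasDistribDeriv IsMult
  rw [← toTemperedDistribution_eq_smulLeftCLM_iff (hasTemperateGrowth_two_pi_I_mul_pow k),
    ← Lp.fourier_toTemperedDistribution_eq, ← Lp.fourier_toTemperedDistribution_eq,
    ← fourier_derivCLM_iterate]
  exact ⟨fun h => by rw [h], fun h => by
    simpa only [FourierTransform.fourierInv_fourier_eq] using congrArg (fun u => 𝓕⁻ u) h⟩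

/-- Lower derivatives come for free: `x^j ≤ 1 + x^k` for `x ≥ 0` and `j ≤ k`, so their transforms
are dominated by `|𝓕 f| + |𝓕 g|`. Thus the Sobolev space is the maximal domain of the multiplier. -/
lemma mem_sobolevSpace_iff (k : ℕ) (f : L2R) :
    f ∈ sobolevSpace k ↔
      ∃ g, IsMult (fun ξ => ((2 * Real.pi * Complex.I) * (ξ : ℂ)) ^ k) f g := by
  constructor
  · intro h
    obtain ⟨g, hg⟩ := h k le_rfl
    exact ⟨g, (hasDistribDeriv_iff _ _ _).1 hg⟩
  · rintro ⟨g, hg⟩ j hj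
    set F : ℝ → ℂ := ((𝓕 f : L2R) : ℝ → ℂ) with hF
    set G : ℝ → ℂ := ((𝓕 g : L2R) : ℝ → ℂ) with hG
    have hmeas : AEStronglyMeasurable
        (fun ξ : ℝ => ((2 * Real.pi * Complex.I) * (ξ : ℂ)) ^ j * F ξ) volume :=
      (Continuous.aestronglyMeasurable (by fun_prop)).mul (Lp.aestronglyMeasurable _)
    have hmem : MemLp (fun ξ : ℝ => ((2 * Real.pi * Complex.I) * (ξ : ℂ)) ^ j * F ξ) 2 volume := by
      refine MemLp.of_le (g := fun ξ => ‖F ξ‖ + ‖G ξ‖)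
        ((Lp.memLp (𝓕 f : L2R)).norm.add (Lp.memLp (𝓕 g : L2R)).norm) hmeas ?_
      unfold IsMult at hg
      filter_upwards [hg] with ξ h
      rw [hG, h, Real.norm_of_nonneg (by positivity), norm_mul, norm_mul, norm_pow, norm_pow,
        ← one_add_mul]
      gcongr
      set x := ‖(2 * Real.pi * Complex.I) * (ξ : ℂ)‖
      have hx : 0 ≤ x := norm_nonneg _
      rcases le_total x 1 with h1 | h1
      · have := pow_le_one₀ hx h1 (n := j)
        have := pow_nonneg hx k
        linarith
      · have := pow_le_pow_right₀ h1 hj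
        linarith
    refine ⟨𝓕⁻ (hmem.toLp _), (hasDistribDeriv_iff _ _ _).2 ?_⟩
    unfold IsMult
    rw [FourierTransform.fourier_fourierInv_eq]
    exact hmem.coeFn_toLp

lemma derivOp_isMult (k : ℕ) (f : (derivOp k).domain) :
    IsMult (fun ξ => ((2 * Real.pi * Complex.I) * (ξ : ℂ)) ^ k) f (derivOp k f) :=
  (hasDistribDeriv_iff _ _ _).1 (f.2 k le_rfl).choose_spec

end Derivatives

/-! ### The Riccati equation for a non-positive multiplication operator. -/

section MultiplicationOperator

variable {A : L2R →ₗ.[ℂ] L2R} {m : ℝ → ℝ}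

lemma memLp_top_of_continuous_of_le {b : ℝ → ℝ} (hb : Continuous b) {M : ℝ}
    (hM : ∀ ξ, |b ξ| ≤ M) : MemLp (fun ξ => (b ξ : ℂ)) ⊤ volume :=
  memLp_top_of_bound (by fun_prop : Continuous fun ξ => (b ξ : ℂ)).aestronglyMeasurable M
    (Filter.Eventually.of_forall fun ξ => by simpa using hM ξ)

/-- `A` is the operator `-m` in the Fourier domain, with its maximal domain. -/
def IsNegMultOperator (A : L2R →ₗ.[ℂ] L2R) (m : ℝ → ℝ) : Prop :=
  ∀ x y, (∃ hx : x ∈ A.domain, A ⟨x, hx⟩ = y) ↔ IsMult (fun ξ => ((-m ξ : ℝ) : ℂ)) x y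

namespace IsNegMultOperator

lemma isMult (hA : IsNegMultOperator A m) (h : A.domain) :
    IsMult (fun ξ => ((-m ξ : ℝ) : ℂ)) h (A h) := (hA _ _).1 ⟨h.2, rfl⟩

lemma re_inner_nonpos (hA : IsNegMultOperator A m) (hm : ∀ ξ, 0 ≤ m ξ) (v : A.domain) :
    (inner ℂ (v : L2R) (A v)).re ≤ 0 := by
  rw [(hA.isMult v).re_inner_eq]
  exact integral_nonpos fun ξ => mul_nonpos_of_nonpos_of_nonneg (by simpa using hm ξ) (by positivity)

/-- The resolvent criterion applies with `R` the multiplier `(1 + m)⁻¹`, bounded by 1 even if `m` is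
unbounded. -/
lemma adjoint_eq (hA : IsNegMultOperator A m) (hm : ∀ ξ, 0 ≤ m ξ) (hmc : Continuous m) :
    A.adjoint = A := by
  have hb : MemLp (fun ξ => (((1 + m ξ)⁻¹ : ℝ) : ℂ)) ⊤ volume := by
    refine memLp_top_of_continuous_of_le (M := 1) ?_ fun ξ => ?_
    · exact (continuous_const.add hmc).inv₀ fun ξ => (add_pos_of_pos_of_nonneg one_pos (hm ξ)).ne'
    · have := hm ξ
      rw [abs_of_nonneg (by positivity)]
      exact inv_le_one_of_one_le₀ (by linarith)
  refine adjoint_eq_self_of_resolvent (isSelfAdjoint_multOp hb) fun x y => (hA x y).trans ?_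
  have hne : ∀ ξ, (1 + (m ξ : ℂ)) ≠ 0 := fun ξ => by
    have := hm ξ
    exact_mod_cast (by positivity : (1 + m ξ) ≠ 0)
  have h1 := isMult_multOp hb (x - y)
  constructor
  · intro h
    refine IsMult.unique (b := fun _ => 1) (f := x) (IsMult.one x) ?_
    refine (((IsMult.one x).sub h).comp h1).congr fun ξ => ?_
    have := hne ξ
    push_cast
    field_simp
    ring
  · intro h
    rw [← h] at h1
    unfold IsMult at *
    rw [L2R.fourier_sub] at h1
    filter_upwards [h1, Lp.coeFn_sub (𝓕 x : L2R) (𝓕 y : L2R)] with ξ h2 h3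
    rw [h3, Pi.sub_apply] at h2
    have := hne ξ
    push_cast at h2 ⊢
    field_simp at h2
    linear_combination h2

variable {c s : ℝ}

/-- The solution symbol of the scalar Riccati equation `-2 m p + s - c p² = 0`. -/
def riccatiSymbol (m : ℝ → ℝ) (c s ξ : ℝ) : ℝ := c⁻¹ * (-m ξ + √(m ξ ^ 2 + c * s))

lemma le_sqrt (hcs : 0 ≤ c * s) (ξ : ℝ) : m ξ ≤ √(m ξ ^ 2 + c * s) :=
  Real.le_sqrt_of_sq_le (by linarith)

lemma riccatiSymbol_nonneg (hc : 0 < c) (hs : 0 < s) (ξ : ℝ) : 0 ≤ riccatiSymbol m c s ξ := by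
  have := le_sqrt (m := m) (mul_pos hc hs).le ξ
  exact mul_nonneg (by positivity) (by linarith)

lemma riccatiSymbol_sq (hc : 0 < c) (hs : 0 < s) (ξ : ℝ) :
    -2 * m ξ * riccatiSymbol m c s ξ + s - c * riccatiSymbol m c s ξ ^ 2 = 0 := by
  have := Real.sq_sqrt (by positivity : 0 ≤ m ξ ^ 2 + c * s)
  unfold riccatiSymbol
  field_simp
  linear_combination -this

lemma continuous_riccatiSymbol (hmc : Continuous m) : Continuous (riccatiSymbol m c s) := by
  unfold riccatiSymbol
  fun_prop

/-- The scalar equation gives `c p² = s - 2 m p ≤ s`. -/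
lemma memLp_riccatiSymbol (hm : ∀ ξ, 0 ≤ m ξ) (hmc : Continuous m) (hc : 0 < c) (hs : 0 < s) :
    MemLp (fun ξ => (riccatiSymbol m c s ξ : ℂ)) ⊤ volume := by
  refine memLp_top_of_continuous_of_le (M := √(s / c)) (continuous_riccatiSymbol hmc) fun ξ => ?_
  have h0 := riccatiSymbol_nonneg (m := m) hc hs ξ
  have h1 := riccatiSymbol_sq (m := m) hc hs ξ
  rw [abs_of_nonneg h0]
  refine Real.le_sqrt_of_sq_le ?_
  rw [le_div_iff₀ hc]
  nlinarith [mul_nonneg (hm ξ) h0]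

/-- The scalar equation gives `2 m p = s - c p² ≤ s`. Boundedness of `m p` is what places the values
of the multiplier `p` in the domain of `A`. -/
lemma memLp_mul_riccatiSymbol (hm : ∀ ξ, 0 ≤ m ξ) (hmc : Continuous m) (hc : 0 < c)
    (hs : 0 < s) : MemLp (fun ξ => ((-(m ξ * riccatiSymbol m c s ξ) : ℝ) : ℂ)) ⊤ volume := by
  refine memLp_top_of_continuous_of_le (M := s)
    (hmc.mul (continuous_riccatiSymbol hmc)).neg fun ξ => ?_
  have h0 := riccatiSymbol_nonneg (m := m) hc hs ξ
  have h1 := riccatiSymbol_sq (m := m) hc hs ξ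
  have h2 := mul_nonneg (hm ξ) h0
  rw [abs_neg, abs_of_nonneg h2]
  nlinarith [mul_nonneg hc.le (sq_nonneg (riccatiSymbol m c s ξ))]

/-- The Fourier multiplier solving the Riccati equation. -/
def riccatiOp (hm : ∀ ξ, 0 ≤ m ξ) (hmc : Continuous m) (hc : 0 < c) (hs : 0 < s) : L2R →L[ℂ] L2R :=
  multOp _ (memLp_riccatiSymbol hm hmc hc hs)

/-- As `P h` lies in the domain of the self-adjoint `A`, the form is `⟨f, (AP + PA + s - cP²) h⟩`,
and the symbol of that operator is the scalar Riccati expression. -/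
lemma riccatiForm_riccatiOp (hA : IsNegMultOperator A m) (hm : ∀ ξ, 0 ≤ m ξ) (hmc : Continuous m)
    (hc : 0 < c) (hs : 0 < s) (h f : A.domain) :
    riccatiForm A (riccatiOp hm hmc hc hs) c s h f = 0 := by
  set P := riccatiOp hm hmc hc hs with hP
  have hPm : ∀ u, IsMult (fun ξ => (riccatiSymbol m c s ξ : ℂ)) u (P u) := isMult_multOp _
  have hy := isMult_multOp (memLp_mul_riccatiSymbol hm hmc hc hs) (h : L2R)
  set y := multOp _ (memLp_mul_riccatiSymbol hm hmc hc hs) (h : L2R)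
  have hAP : IsMult (fun ξ => ((-m ξ : ℝ) : ℂ)) (P h) y := by
    have h1 := hPm h
    unfold IsMult at *
    filter_upwards [h1, hy] with ξ h1 h2
    rw [h1, h2]
    push_cast
    ring
  obtain ⟨hx, hAy⟩ := (hA _ _).2 hAP
  have hsym : inner ℂ (A f) (P h) = inner ℂ (f : L2R) y := by
    have hadj := hA.adjoint_eq hm hmc
    have hd : Dense (A.domain : Set L2R) :=
      IsSelfAdjoint.dense_domain (LinearPMap.isSelfAdjoint_def.2 hadj)
    have := A.adjoint_isFormalAdjoint hd
    rw [hadj] at this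
    rw [← hAy]
    exact this f ⟨P h, hx⟩
  have hzero : y + P (A h) + (s : ℂ) • (h : L2R) - (c : ℂ) • P (P h) = 0 := by
    have h1 := ((hy.add ((hA.isMult h).comp (hPm _))).add ((IsMult.one (h : L2R)).smul (s : ℂ))).sub
      (((hPm h).comp (hPm _)).smul (c : ℂ))
    have h2 : IsMult (fun _ => 0) (h : L2R) 0 := by
      simpa using (IsMult.one (h : L2R)).smul 0
    refine h1.unique (h2.congr fun ξ => ?_)
    have h3 := riccatiSymbol_sq (m := m) hc hs ξ
    have h4 : ((-2 * m ξ * riccatiSymbol m c s ξ + s - c * riccatiSymbol m c s ξ ^ 2 : ℝ) : ℂ) = 0 := by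
      rw [h3, Complex.ofReal_zero]
    push_cast at h4 ⊢
    linear_combination -h4
  unfold riccatiForm
  rw [hsym, ← inner_add_right, ← inner_add_right, ← inner_sub_right, hzero, inner_zero_right]

/-- The closed loop `cP - A` has symbol `c p + m = r = √(m² + cs) > 0`, so its Cayley symbol `(1 -
r)/(1 + r)` has modulus below 1. The preimage of `g` under `1 + cP - A` is `(1 + r)⁻¹ g`, which is
in the domain because `m ≤ r`. -/
lemma eq_riccatiOp (hA : IsNegMultOperator A m) (hm : ∀ ξ, 0 ≤ m ξ) (hmc : Continuous m)
    (hc : 0 < c) (hs : 0 < s) {P' : L2R →L[ℂ] L2R} (hP' : P'.IsPositive)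
    (hric : ∀ h f, riccatiForm A P' c s h f = 0) : P' = riccatiOp hm hmc hc hs := by
  set P := riccatiOp hm hmc hc hs with hP
  have hPm : ∀ u, IsMult (fun ξ => (riccatiSymbol m c s ξ : ℂ)) u (P u) := isMult_multOp _
  set r : ℝ → ℝ := fun ξ => √(m ξ ^ 2 + c * s) with hr
  have hrc : Continuous r := by fun_prop
  have hrm : ∀ ξ, m ξ ≤ r ξ := le_sqrt (mul_pos hc hs).le
  have hr0 : ∀ ξ, 0 < r ξ := fun ξ => Real.sqrt_pos.2 (by positivity)
  have hne : ∀ ξ, (1 + (r ξ : ℂ)) ≠ 0 := fun ξ => by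
    have := hr0 ξ
    exact_mod_cast (by positivity : (1 + r ξ) ≠ 0)
  have hcP : ∀ ξ, (c : ℂ) * riccatiSymbol m c s ξ = -m ξ + r ξ := fun ξ => by
    rw [← Complex.ofReal_mul, riccatiSymbol, mul_inv_cancel_left₀ hc.ne']
    push_cast
    rfl
  have hinv : Continuous fun ξ => (1 + r ξ)⁻¹ := (continuous_const.add hrc).inv₀ fun ξ =>
    (add_pos one_pos (hr0 ξ)).ne'
  have hb1 : MemLp (fun ξ => (((1 + r ξ)⁻¹ : ℝ) : ℂ)) ⊤ volume := by
    refine memLp_top_of_continuous_of_le (M := 1) hinv fun ξ => ?_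
    have := hr0 ξ
    rw [abs_of_nonneg (by positivity)]
    exact inv_le_one_of_one_le₀ (by linarith)
  have hb2 : MemLp (fun ξ => ((-m ξ * (1 + r ξ)⁻¹ : ℝ) : ℂ)) ⊤ volume := by
    refine memLp_top_of_continuous_of_le (M := 1) (hmc.neg.mul hinv) fun ξ => ?_
    have h1 := hr0 ξ
    have h2 := hrm ξ
    have h3 := hm ξ
    rw [abs_mul, abs_neg, abs_of_nonneg h3, abs_of_nonneg (by positivity), ← div_eq_mul_inv,
      div_le_one (by positivity)]
    linarith
  have hb3 : ∀ ξ, |(1 - r ξ) * (1 + r ξ)⁻¹| < 1 := fun ξ => by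
    have h1 := hr0 ξ
    rw [← div_eq_mul_inv, abs_div, abs_of_pos (by positivity : 0 < 1 + r ξ),
      div_lt_one (by positivity), abs_lt]
    constructor <;> linarith
  have hb4 : MemLp (fun ξ => (((1 - r ξ) * (1 + r ξ)⁻¹ : ℝ) : ℂ)) ⊤ volume :=
    memLp_top_of_continuous_of_le (M := 1) ((continuous_const.sub hrc).mul hinv)
      fun ξ => (hb3 ξ).le
  refine riccati_unique (C := multOp _ hb4) (hA.adjoint_eq hm hmc) (hA.re_inner_nonpos hm) hc.le
    hP' (hA.riccatiForm_riccatiOp hm hmc hc hs) hric (fun g => ?_) fun g =>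
      tendsto_multOp_pow hb4 (fun ξ => by simpa only [Complex.norm_real, Real.norm_eq_abs] using hb3 ξ) g
  have h1 := isMult_multOp hb1 g
  have h2 := isMult_multOp hb2 g
  have h3 := isMult_multOp hb4 g
  set h := multOp _ hb1 g
  set y := multOp _ hb2 g
  have hdom : IsMult (fun ξ => ((-m ξ : ℝ) : ℂ)) h y := by
    unfold IsMult at *
    filter_upwards [h1, h2] with ξ h1 h2
    rw [h1, h2]
    push_cast
    ring
  obtain ⟨hx, hAy⟩ := (hA _ _).2 hdom
  refine ⟨⟨h, hx⟩, ?_, ?_⟩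
  · rw [hAy]
    refine (h1.add (((h1.comp (hPm h)).smul (c : ℂ)).sub h2)).unique
      ((IsMult.one g).congr fun ξ => ?_)
    rw [← mul_assoc, hcP]
    have := hne ξ
    push_cast
    field_simp
    ring
  · rw [hAy]
    refine (h1.sub (((h1.comp (hPm h)).smul (c : ℂ)).sub h2)).unique (h3.congr fun ξ => ?_)
    rw [← mul_assoc, hcP]
    have := hne ξ
    push_cast
    field_simp
    ring

end IsNegMultOperator

end MultiplicationOperator

/-! ### The Kalman gain of the plant. -/

section Plant

variable {n : ℕ} {a σw σv : ℝ}

/-- `I^(2n) = (-1)^n`, and the parity condition makes `a (-1)^n = -|a|`: this is the source of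
dissipativity. -/
lemma mul_two_pi_I_mul_pow (ha_odd : Odd n → 0 < a) (ha_even : Even n → a < 0) (ξ : ℝ) :
    (a : ℂ) * ((2 * Real.pi * Complex.I) * (ξ : ℂ)) ^ (2 * n) =
      ((-(|a| * (2 * Real.pi * ξ) ^ (2 * n)) : ℝ) : ℂ) := by
  have h1 : ((2 * Real.pi * Complex.I) * (ξ : ℂ)) ^ (2 * n) =
      (-1) ^ n * ((2 * Real.pi * ξ : ℝ) : ℂ) ^ (2 * n) := by
    rw [← Complex.I_sq, ← pow_mul, ← mul_pow]
    push_cast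
    ring
  rw [h1]
  rcases Nat.even_or_odd n with h | h
  · rw [h.neg_one_pow, abs_of_neg (ha_even h)]
    push_cast
    ring
  · rw [h.neg_one_pow, abs_of_pos (ha_odd h)]
    push_cast
    ring

lemma coeff_ne_zero (ha_odd : Odd n → 0 < a) (ha_even : Even n → a < 0) : a ≠ 0 := by
  rcases Nat.even_or_odd n with h | h
  · exact (ha_even h).ne
  · exact (ha_odd h).ne'

lemma isNegMultOperator_monomialPlant (ha_odd : Odd n → 0 < a) (ha_even : Even n → a < 0) :
    IsNegMultOperator (monomialPlant n a σw σv).A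
      (fun ξ => |a| * (2 * Real.pi * ξ) ^ (2 * n)) := by
  have ha : (a : ℂ) ≠ 0 := by exact_mod_cast coeff_ne_zero ha_odd ha_even
  intro x y
  constructor
  · rintro ⟨hx, rfl⟩
    exact ((derivOp_isMult (2 * n) ⟨x, hx⟩).smul (a : ℂ)).congr
      (mul_two_pi_I_mul_pow ha_odd ha_even)
  · intro h
    have h1 : IsMult (fun ξ => ((2 * Real.pi * Complex.I) * (ξ : ℂ)) ^ (2 * n)) x
        ((a : ℂ)⁻¹ • y) := (h.smul (a : ℂ)⁻¹).congr fun ξ => by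
      rw [← mul_two_pi_I_mul_pow ha_odd ha_even, inv_mul_cancel_left₀ ha]
    have hx : x ∈ sobolevSpace (2 * n) := (mem_sobolevSpace_iff _ _).2 ⟨_, h1⟩
    refine ⟨hx, ?_⟩
    change (a : ℂ) • derivOp (2 * n) ⟨x, hx⟩ = y
    rw [(derivOp_isMult (2 * n) ⟨x, hx⟩).unique h1, smul_inv_smul₀ ha]

lemma noiseInv_monomialPlant (hσv : 0 < σv) : (monomialPlant n a σw σv).noiseInv =
    (((σv ^ 2)⁻¹ : ℝ) : ℂ) • (1 : L2R →L[ℂ] L2R) := by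
  have hne : (σv : ℂ) ≠ 0 := by exact_mod_cast hσv.ne'
  have h1 : (monomialPlant n a σw σv).G *
      ContinuousLinearMap.adjoint (monomialPlant n a σw σv).G =
      ((σv : ℂ) ^ 2) • (1 : L2R →L[ℂ] L2R) := by
    change ((σv : ℂ) • (1 : L2R →L[ℂ] L2R)) * star ((σv : ℂ) • (1 : L2R →L[ℂ] L2R)) = _
    rw [star_smul, star_one, Complex.star_def, Complex.conj_ofReal, smul_mul_smul_comm, mul_one, sq]
  unfold Plant.noiseInv
  rw [h1]
  have hu : IsUnit (((σv : ℂ) ^ 2) • (1 : L2R →L[ℂ] L2R)) := by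
    rw [← Algebra.algebraMap_eq_smul_one]
    exact (IsUnit.mk0 _ (pow_ne_zero 2 hne)).map (algebraMap ℂ (L2R →L[ℂ] L2R))
  refine (((Ring.eq_mul_inverse_iff_mul_eq _ 1 _ hu).2 ?_).trans (one_mul _)).symm
  rw [smul_mul_smul_comm, mul_one]
  push_cast
  rw [inv_mul_cancel₀ (pow_ne_zero 2 hne), one_smul]

lemma isErrorCovariance_monomialPlant_iff (ha_odd : Odd n → 0 < a) (ha_even : Even n → a < 0)
    (hσv : 0 < σv) (P : L2R →L[ℂ] L2R) :
    (monomialPlant n a σw σv).IsErrorCovariance P ↔ P.IsPositive ∧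
      ∀ h f, riccatiForm (monomialPlant n a σw σv).A P (((σv ^ 2)⁻¹ : ℝ) : ℂ)
        ((σw ^ 2 : ℝ) : ℂ) h f = 0 := by
  have hadj := (isNegMultOperator_monomialPlant (σw := σw) (σv := σv) ha_odd ha_even).adjoint_eq
    (fun ξ => mul_nonneg (abs_nonneg a) (by rw [pow_mul]; positivity)) (by fun_prop)
  unfold Plant.IsErrorCovariance
  rw [hadj, noiseInv_monomialPlant hσv]
  refine and_congr_right fun _ => forall_congr' fun h => forall_congr' fun f => ?_
  have hB : (monomialPlant n a σw σv).B
      (ContinuousLinearMap.adjoint (monomialPlant n a σw σv).B (h : L2R)) =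
      ((σw ^ 2 : ℝ) : ℂ) • (h : L2R) := by
    change (σw : ℂ) • (star ((σw : ℂ) • (1 : L2R →L[ℂ] L2R))) (h : L2R) = _
    rw [star_smul, star_one, Complex.star_def, Complex.conj_ofReal]
    change (σw : ℂ) • (σw : ℂ) • (h : L2R) = _
    rw [smul_smul]
    push_cast
    rw [sq]
  have hC : ContinuousLinearMap.adjoint (monomialPlant n a σw σv).C = 1 :=
    star_one (L2R →L[ℂ] L2R)
  rw [hB, hC]
  have hP : P ((1 : L2R →L[ℂ] L2R) (((((σv ^ 2)⁻¹ : ℝ) : ℂ) • (1 : L2R →L[ℂ] L2R))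
      ((monomialPlant n a σw σv).C (P h)))) = (((σv ^ 2)⁻¹ : ℝ) : ℂ) • P (P h) :=
    P.map_smul _ _
  rw [hP]
  rfl

/-- The symbol of the Kalman gain. -/
def gainSymbol (n : ℕ) (a σw σv lam : ℝ) : ℝ :=
  -|a| * lam ^ (2 * n) + √(a ^ 2 * lam ^ (4 * n) + σw ^ 2 / σv ^ 2)

theorem exists_forall_isKalmanGain_iff_eq (ha_odd : Odd n → 0 < a) (ha_even : Even n → a < 0)
    (hσw : 0 < σw) (hσv : 0 < σv) :
    ∃ L₀ : L2R →L[ℂ] L2R, (∀ L, (monomialPlant n a σw σv).IsKalmanGain L ↔ L = L₀) ∧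
      IsFourierSymbol L₀ (fun lam => (gainSymbol n a σw σv lam : ℂ)) := by
  set m : ℝ → ℝ := fun ξ => |a| * (2 * Real.pi * ξ) ^ (2 * n) with hm_def
  have hA := isNegMultOperator_monomialPlant (σw := σw) (σv := σv) ha_odd ha_even
  have hm : ∀ ξ, 0 ≤ m ξ := fun ξ => mul_nonneg (abs_nonneg a) (by rw [pow_mul]; positivity)
  have hmc : Continuous m := by fun_prop
  have hc : 0 < (σv ^ 2)⁻¹ := by positivity
  have hs : 0 < σw ^ 2 := by positivity
  have hgain : ∀ P : L2R →L[ℂ] L2R, P * ContinuousLinearMap.adjoint (monomialPlant n a σw σv).C *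
      (monomialPlant n a σw σv).noiseInv = (((σv ^ 2)⁻¹ : ℝ) : ℂ) • P := fun P => by
    have hC : ContinuousLinearMap.adjoint (monomialPlant n a σw σv).C = 1 :=
      star_one (L2R →L[ℂ] L2R)
    rw [hC, noiseInv_monomialPlant hσv, mul_one, mul_smul_comm, mul_one]
  refine ⟨(((σv ^ 2)⁻¹ : ℝ) : ℂ) • IsNegMultOperator.riccatiOp hm hmc hc hs, fun L => ?_, ?_, ?_⟩
  · unfold Plant.IsKalmanGain
    simp_rw [hgain, isErrorCovariance_monomialPlant_iff ha_odd ha_even hσv]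
    constructor
    · rintro ⟨P, ⟨hP, hric⟩, rfl⟩
      rw [hA.eq_riccatiOp hm hmc hc hs hP hric]
    · rintro rfl
      exact ⟨_, ⟨isPositive_multOp _ (IsNegMultOperator.riccatiSymbol_nonneg hc hs),
        hA.riccatiForm_riccatiOp hm hmc hc hs⟩, rfl⟩
  · unfold gainSymbol
    fun_prop
  · intro h
    refine ((isMult_multOp (IsNegMultOperator.memLp_riccatiSymbol hm hmc hc hs) h).smul
      (((σv ^ 2)⁻¹ : ℝ) : ℂ)).congr fun ξ => ?_
    rw [← Complex.ofReal_mul, IsNegMultOperator.riccatiSymbol, mul_inv_cancel_left₀ hc.ne']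
    change _ = ((-|a| * (2 * Real.pi * ξ) ^ (2 * n) + √(a ^ 2 * (2 * Real.pi * ξ) ^ (4 * n) +
      σw ^ 2 / σv ^ 2) : ℝ) : ℂ)
    simp only [hm_def]
    congr 3
    · ring
    · congr 1
      · rw [mul_pow, sq_abs]
        ring
      · rw [inv_mul_eq_div]

end Plant

/-! ### Analytic continuation along paths. -/

section Continuation

variable {p q : ℂ} {γ : Path p q} {F F' : unitInterval → ℂ → ℂ}

/-- Permanence of functional relations: a germ that is zero stays zero under continuation. -/
theorem IsContinuationAlong.eventuallyEq_zero (hF : IsContinuationAlong γ F)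
    (h0 : F 0 =ᶠ[𝓝 p] 0) (t : unitInterval) : F t =ᶠ[𝓝 (γ t)] 0 := by
  set S : Set unitInterval := {t | F t =ᶠ[𝓝 (γ t)] 0} with hS
  -- By isolation of zeros, near `γ t` the function `F t` either vanishes identically or has no zero
  -- except possibly `γ t` itself.
  have hloc : ∀ t, ∀ᶠ s in 𝓝 t, (s ∈ S ↔ t ∈ S) := by
    intro t
    obtain ⟨han, hev⟩ := hF t
    have hγ : Filter.Tendsto γ (𝓝 t) (𝓝 (γ t)) := γ.continuous.tendsto t
    rcases han.eventually_eq_zero_or_eventually_ne_zero with h | h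
    · filter_upwards [hev, hγ.eventually h.eventually_nhds] with s h1 h2
      exact ⟨fun _ => h, fun _ => h1.trans h2⟩
    · have hne : t ∉ S := fun ht => by
        have h1 : ∀ᶠ z in 𝓝[≠] (γ t), F t z = 0 := ht.filter_mono nhdsWithin_le_nhds
        obtain ⟨z, h2, h3⟩ := (h.and h1).exists
        exact h2 h3
      rw [eventually_nhdsWithin_iff] at h
      filter_upwards [hev, hγ.eventually h] with s h1 h2
      refine ⟨fun hs => ?_, fun ht => absurd ht hne⟩
      have h3 : F t =ᶠ[𝓝 (γ s)] 0 := h1.symm.trans hs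
      -- The path may stay at or return to `γ t`, where a zero is allowed; there the whole germs are
      -- compared.
      by_cases h4 : γ s = γ t
      · rwa [h4] at h3
      · exact absurd h3.eq_of_nhds (h2 h4)
  have hclopen : IsClopen S := by
    constructor
    · rw [← isOpen_compl_iff, isOpen_iff_eventually]
      intro t ht
      filter_upwards [hloc t] with s hs
      exact fun h => ht (hs.1 h)
    · rw [isOpen_iff_eventually]
      intro t ht
      filter_upwards [hloc t] with s hs
      exact hs.2 ht
  have h0S : (0 : unitInterval) ∈ S := by
    change F 0 =ᶠ[𝓝 (γ 0)] 0
    rwa [γ.source]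
  have ht : t ∈ S := hclopen.eq_univ ⟨0, h0S⟩ ▸ Set.mem_univ t
  exact ht

theorem IsContinuationAlong.sub (hF : IsContinuationAlong γ F) (hF' : IsContinuationAlong γ F') :
    IsContinuationAlong γ (fun t => F t - F' t) := fun t =>
  ⟨(hF t).1.sub (hF' t).1, by
    filter_upwards [(hF t).2, (hF' t).2] with s h1 h2
    exact h1.sub h2⟩

theorem ContinuesTo.unique {f g g' : ℂ → ℂ} (h : ContinuesTo γ f g) (h' : ContinuesTo γ f g') :
    g =ᶠ[𝓝 q] g' := by
  obtain ⟨F, hF, h0, h1⟩ := h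
  obtain ⟨F', hF', h0', h1'⟩ := h'
  have hz := (hF.sub hF').eventuallyEq_zero (by
    filter_upwards [h0, h0'] with z h2 h3
    simp [h2, h3]) 1
  rw [γ.target] at hz
  filter_upwards [h1, h1', hz] with z h2 h3 h4
  rw [← h2, ← h3]
  exact sub_eq_zero.1 h4

end Continuation

/-! ### Branches and monodromy of `k + √P`. -/

section SquareRoots

/-- `f` is near `q` a branch of `k + √P`. -/
def IsSqrtBranch (k P f : ℂ → ℂ) (q : ℂ) : Prop :=
  AnalyticAt ℂ f q ∧ ∀ᶠ z in 𝓝 q, (f z - k z) ^ 2 = P z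

variable {k P f g : ℂ → ℂ} {p q : ℂ}

/-- The function `(F t - k)² - P` is itself continued along the path, and it starts as the zero
germ. -/
lemma IsSqrtBranch.continuesTo (hk : ∀ z, AnalyticAt ℂ k z) (hP : ∀ z, AnalyticAt ℂ P z)
    (hf : IsSqrtBranch k P f p) {γ : Path p q} (h : ContinuesTo γ f g) : IsSqrtBranch k P g q := by
  obtain ⟨F, hF, h0, h1⟩ := h
  have hrel : IsContinuationAlong γ (fun t z => (F t z - k z) ^ 2 - P z) := fun t =>
    ⟨(((hF t).1.sub (hk _)).pow 2).sub (hP _), by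
      filter_upwards [(hF t).2] with s hs
      filter_upwards [hs] with z hz
      rw [hz]⟩
  have hz := hrel.eventuallyEq_zero (by
    filter_upwards [h0, hf.2] with z h2 h3
    simp [h2, h3]) 1
  have han := (hF 1).1
  rw [γ.target] at hz han
  refine ⟨han.congr h1, ?_⟩
  filter_upwards [h1, hz] with z h2 h3
  rw [← h2]
  exact sub_eq_zero.1 h3

/-- There is no analytic branch at a simple zero of the radicand. -/
lemma IsSqrtBranch.deriv_eq_zero (hk : ∀ z, AnalyticAt ℂ k z) (hf : IsSqrtBranch k P f q)
    (h0 : P q = 0) : deriv P q = 0 := by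
  have hd : DifferentiableAt ℂ (fun z => f z - k z) q := (hf.1.sub (hk q)).differentiableAt
  have hval : f q - k q = 0 := by
    have := hf.2.self_of_nhds
    rw [h0] at this
    exact pow_eq_zero_iff two_ne_zero |>.1 this
  have hev : P =ᶠ[𝓝 q] fun z => (f z - k z) ^ 2 := by
    filter_upwards [hf.2] with z hz using hz.symm
  rw [hev.deriv_eq, deriv_fun_pow hd, hval]
  simp

/-- The product `(f - g)(f + g - 2k)` vanishes near `q`, and the second factor is nonzero there
because `P q ≠ 0`. -/
lemma IsSqrtBranch.eventuallyEq (hk : ∀ z, AnalyticAt ℂ k z) (hf : IsSqrtBranch k P f q)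
    (hg : IsSqrtBranch k P g q) (hne : P q ≠ 0) (hval : f q = g q) : f =ᶠ[𝓝 q] g := by
  have hcont : ContinuousAt (fun z => f z + g z - 2 * k z) q :=
    (hf.1.continuousAt.add hg.1.continuousAt).sub (continuousAt_const.mul (hk q).continuousAt)
  have h0 : f q + g q - 2 * k q ≠ 0 := fun h => hne <| by
    rw [← hf.2.self_of_nhds, pow_eq_zero_iff two_ne_zero]
    rw [← hval] at h
    linear_combination h / 2
  filter_upwards [hf.2, hg.2, hcont.eventually_ne h0] with z h1 h2 h3
  have : (f z - g z) * (f z + g z - 2 * k z) = 0 := by linear_combination h1 - h2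
  rcases mul_eq_zero.1 this with h | h
  · exact sub_eq_zero.1 h
  · exact absurd h h3

/-- The branch of `k + √P` near `q` with value `k q + w` at `q`. -/
def sqrtBranch (k P : ℂ → ℂ) (w q z : ℂ) : ℂ := k z + w * (P z / P q) ^ (2⁻¹ : ℂ)

lemma sqrtBranch_self (hne : P q ≠ 0) (w : ℂ) : sqrtBranch k P w q q = k q + w := by
  simp [sqrtBranch, div_self hne]

lemma sqrtBranch_sub_sq (hne : P q ≠ 0) {w : ℂ} (hw : w ^ 2 = P q) (z : ℂ) :
    (sqrtBranch k P w q z - k z) ^ 2 = P z := by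
  rw [sqrtBranch, add_sub_cancel_left, mul_pow, Complex.cpow_ofNat_inv_pow, hw]
  field_simp

lemma isSqrtBranch_sqrtBranch (hk : ∀ z, AnalyticAt ℂ k z) (hP : ∀ z, AnalyticAt ℂ P z)
    (hne : P q ≠ 0) {w : ℂ} (hw : w ^ 2 = P q) : IsSqrtBranch k P (sqrtBranch k P w q) q := by
  refine ⟨(hk q).add (analyticAt_const.mul ?_), Filter.Eventually.of_forall (sqrtBranch_sub_sq hne hw)⟩
  -- Normalizing by `P q` puts the base of the power at 1, away from the cut, whatever the argument
  -- of `P q`.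
  refine AnalyticAt.cpow ((hP q).div analyticAt_const hne) analyticAt_const ?_
  rw [div_self hne]
  exact Complex.one_mem_slitPlane

/-- A continuous choice of square root of `P` along a path gives an analytic continuation. -/
lemma isContinuationAlong_sqrtBranch (hk : ∀ z, AnalyticAt ℂ k z) (hP : ∀ z, AnalyticAt ℂ P z)
    (γ : Path p q) (hne : ∀ t, P (γ t) ≠ 0) {w : unitInterval → ℂ} (hwc : Continuous w)
    (hw : ∀ t, w t ^ 2 = P (γ t)) :
    IsContinuationAlong γ (fun t => sqrtBranch k P (w t) (γ t)) := by
  intro t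
  have hb := isSqrtBranch_sqrtBranch hk hP (hne t) (hw t)
  refine ⟨hb.1, ?_⟩
  have hγ : Filter.Tendsto γ (𝓝 t) (𝓝 (γ t)) := γ.continuous.tendsto t
  -- `w s` and the branch chosen at time `t`, evaluated at `γ s`, are roots of the same number; a
  -- nonzero sum excludes opposite signs.
  have hcont : ContinuousAt (fun s => w s + (sqrtBranch k P (w t) (γ t) (γ s) - k (γ s))) t := by
    refine hwc.continuousAt.add (ContinuousAt.sub ?_ ?_)
    · exact ContinuousAt.comp (f := γ) hb.1.continuousAt γ.continuous.continuousAt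
    · exact ContinuousAt.comp (f := γ) (hk _).continuousAt γ.continuous.continuousAt
  have h0 : w t + (sqrtBranch k P (w t) (γ t) (γ t) - k (γ t)) ≠ 0 := by
    rw [sqrtBranch_self (hne t), add_sub_cancel_left, ← two_mul]
    refine mul_ne_zero two_ne_zero fun h => hne t ?_
    rw [← hw, h, zero_pow two_ne_zero]
  filter_upwards [hcont.eventually_ne h0, hγ.eventually hb.1.eventually_analyticAt]
    with s h1 h2
  refine (isSqrtBranch_sqrtBranch hk hP (hne s) (hw s)).eventuallyEq hk
    ⟨h2, Filter.Eventually.of_forall (sqrtBranch_sub_sq (hne t) (hw t))⟩ (hne s) ?_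
  rw [sqrtBranch_self (hne s)]
  have h3 := sqrtBranch_sub_sq (k := k) (hne t) (hw t) (γ s)
  have h4 : (w s - (sqrtBranch k P (w t) (γ t) (γ s) - k (γ s))) *
      (w s + (sqrtBranch k P (w t) (γ t) (γ s) - k (γ s))) = 0 := by
    linear_combination hw s - h3
  rcases mul_eq_zero.1 h4 with h | h
  · linear_combination h
  · exact absurd h h1

lemma IsSqrtBranch.continuesTo_sqrtBranch (hk : ∀ z, AnalyticAt ℂ k z)
    (hP : ∀ z, AnalyticAt ℂ P z) (hf : IsSqrtBranch k P f p) (γ : Path p q)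
    (hne : ∀ t, P (γ t) ≠ 0) {w : unitInterval → ℂ} (hwc : Continuous w)
    (hw : ∀ t, w t ^ 2 = P (γ t)) (h0 : w 0 = f p - k p) :
    ContinuesTo γ f (sqrtBranch k P (w 1) q) := by
  have hp : P p ≠ 0 := by simpa using hne 0
  refine ⟨_, isContinuationAlong_sqrtBranch hk hP γ hne hwc hw, ?_, ?_⟩
  · simp only [γ.source]
    refine (isSqrtBranch_sqrtBranch hk hP hp (by simpa using hw 0)).eventuallyEq hk hf hp ?_
    rw [sqrtBranch_self hp, h0]
    ring
  · simp only [γ.target]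
    exact Filter.EventuallyEq.rfl

/-- Adjust the sign of a square root so as to have a prescribed value at a point. -/
lemma exists_sqrt_with_value {X : Type*} {w Q : X → ℂ} {x₀ : X} (hw : ∀ x, w x ^ 2 = Q x)
    (hne : Q x₀ ≠ 0) {w₀ : ℂ} (hw₀ : w₀ ^ 2 = Q x₀) :
    ∃ c : ℂ, c * w x₀ = w₀ ∧ ∀ x, (c * w x) ^ 2 = Q x := by
  have h0 : w x₀ ≠ 0 := fun h => hne (by rw [← hw, h, zero_pow two_ne_zero])
  refine ⟨w₀ / w x₀, div_mul_cancel₀ _ h0, fun x => ?_⟩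
  rw [mul_pow, div_pow, hw₀, hw, hw, div_self hne, one_mul]

lemma isSimplyConnected_of_convex {E : Type*} [AddCommGroup E] [Module ℝ E] [TopologicalSpace E]
    [IsTopologicalAddGroup E] [ContinuousSMul ℝ E] {s : Set E} (hs : Convex ℝ s)
    (hne : s.Nonempty) : IsSimplyConnected s :=
  haveI := hs.contractibleSpace hne
  SimplyConnectedSpace.ofContractible s

/-- Pulled back to the parameter line, which is simply connected, the nonvanishing `P ∘ γ` has a
continuous square root. -/
lemma IsSqrtBranch.exists_continuesTo (hk : ∀ z, AnalyticAt ℂ k z)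
    (hP : ∀ z, AnalyticAt ℂ P z) (hf : IsSqrtBranch k P f p) (γ : Path p q)
    (hne : ∀ t, P (γ t) ≠ 0) : ∃ g, ContinuesTo γ f g := by
  have hPc : Continuous P := continuous_iff_continuousAt.2 fun z => (hP z).continuousAt
  obtain ⟨w, hwc, hw⟩ := Complex.exists_continuousOn_pow_eq
    (isSimplyConnected_of_convex (convex_univ (E := ℝ)) Set.univ_nonempty) isOpen_univ
    (g := fun t => P (γ.extend t)) (hPc.comp γ.continuous_extend).continuousOn
    (by rintro ⟨t, -, ht⟩; exact hne _ ht) two_ne_zero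
  have hw' : ∀ t : unitInterval, w t ^ 2 = P (γ t) := fun t => by rw [hw, γ.extend_extends']
  obtain ⟨c, hc, hcw⟩ := exists_sqrt_with_value hw' (hne 0) (w₀ := f p - k p)
    (by simpa using hf.2.self_of_nhds)
  exact ⟨_, hf.continuesTo_sqrtBranch hk hP γ hne
    (continuous_const.mul ((continuousOn_univ.1 hwc).comp continuous_subtype_val)) hcw hc⟩

lemma isPathConnected_ball_diff_singleton (z₀ : ℂ) {r : ℝ} (hr : 0 < r) :
    IsPathConnected (Metric.ball z₀ r \ {z₀}) := by
  have h := isPathConnected_compl_singleton_of_one_lt_rank (E := ℂ)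
    (by simp [Complex.rank_real_complex]) (0 : ℂ)
  set e := OpenPartialHomeomorph.univBall z₀ r with he
  have himage : e '' {0}ᶜ = Metric.ball z₀ r \ {z₀} := by
    have hinj : Set.InjOn e Set.univ := by
      rw [← OpenPartialHomeomorph.univBall_source z₀ r]
      exact e.injOn
    have huniv : e '' Set.univ = Metric.ball z₀ r := by
      rw [← OpenPartialHomeomorph.univBall_target z₀ hr, ← e.image_source_eq_target,
        OpenPartialHomeomorph.univBall_source]
    rw [Set.compl_eq_univ_sdiff, hinj.image_sdiff_subset (Set.subset_univ _), huniv,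
      Set.image_singleton, OpenPartialHomeomorph.univBall_apply_zero]
  rw [← himage]
  exact h.image (OpenPartialHomeomorph.continuous_univBall z₀ r)

/-- Branch points of `k + √P` are zeros of `P`, when the zeros of `P` are simple. -/
theorem IsBranchPoint.radicand_eq_zero (hk : ∀ z, AnalyticAt ℂ k z) (hP : ∀ z, AnalyticAt ℂ P z)
    (hsimple : ∀ z, P z = 0 → deriv P z ≠ 0) (hf : IsSqrtBranch k P f p) {z₀ : ℂ}
    (h : IsBranchPoint f p z₀) : P z₀ = 0 := by
  obtain ⟨r, hr, q, hq, g, ⟨γ, hγ⟩, hcont, γ', hγ', g', hg', hneq⟩ := h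
  by_contra hz₀
  have hg := hf.continuesTo hk hP hγ
  -- Continuing to a zero of `P` in the punctured disc would produce an analytic branch at a simple
  -- zero.
  have hne : ∀ z ∈ Metric.ball z₀ r, P z ≠ 0 := by
    intro z hz h0
    have hzz : z ≠ z₀ := fun h => hz₀ (h ▸ h0)
    obtain ⟨δ, hδ⟩ := (isPathConnected_ball_diff_singleton z₀ hr).joinedIn q hq z ⟨hz, hzz⟩
    obtain ⟨u, hu⟩ := hcont z δ hδ
    exact hsimple z h0 ((hg.continuesTo hk hP hu).deriv_eq_zero hk h0)
  have hPc : Continuous P := continuous_iff_continuousAt.2 fun z => (hP z).continuousAt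
  -- Now `P` has a single-valued root on the full disc, so continuation along any loop in it returns
  -- to the initial germ.
  obtain ⟨w, hwc, hw⟩ := Complex.exists_continuousOn_pow_eq
    (isSimplyConnected_of_convex (convex_ball z₀ r) (Metric.nonempty_ball.2 hr)) Metric.isOpen_ball
    (g := P) hPc.continuousOn (by rintro ⟨z, hz, h0⟩; exact hne z hz h0) two_ne_zero
  have hPq := hne q hq.1
  obtain ⟨c, hc, hcw⟩ := exists_sqrt_with_value hw hPq hg.2.self_of_nhds
  have hwγ : Continuous fun t => c * w (γ' t) :=
    continuous_const.mul (hwc.comp_continuous γ'.continuous fun t => (hγ' t).1)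
  have hend := hg.continuesTo_sqrtBranch hk hP γ' (fun t => hne _ (hγ' t).1) hwγ
    (fun t => hcw _) (by simpa using hc)
  refine hneq ((hg'.unique hend).trans ?_)
  rw [γ'.target, hc]
  refine (isSqrtBranch_sqrtBranch hk hP hPq hg.2.self_of_nhds).eventuallyEq hk hg hPq ?_
  rw [sqrtBranch_self hPq]
  ring

/-- A simple zero of `P` seen from the base point along a segment is a branch point of `k + √P`. -/
theorem isBranchPoint_of_simple_zero (hk : ∀ z, AnalyticAt ℂ k z) (hP : ∀ z, AnalyticAt ℂ P z)
    (hf : IsSqrtBranch k P f p) {z₀ : ℂ} (h0 : P z₀ = 0) (h1 : deriv P z₀ ≠ 0)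
    (hseg : ∀ t : ℝ, 0 ≤ t → t < 1 → P (AffineMap.lineMap p z₀ t) ≠ 0) :
    IsBranchPoint f p z₀ := by
  have hPd : ∀ z, DifferentiableAt ℂ P z := fun z => (hP z).differentiableAt
  -- Write `P z = (z - z₀) h z` with `h z₀ ≠ 0`. On a small disc `h` has a single-valued root, so
  -- all monodromy comes from `z - z₀`.
  set h := dslope P z₀ with hh
  have hhc : Continuous h := by
    rw [continuous_iff_continuousAt]
    intro z
    by_cases hz : z = z₀
    · rw [hz]
      exact continuousAt_dslope_same.2 (hPd z₀)
    · exact (continuousAt_dslope_of_ne hz).2 (hPd z).continuousAt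
  have hPh : ∀ z, P z = (z - z₀) * h z := fun z => by
    have := sub_smul_dslope P z₀ z
    rw [h0, sub_zero, smul_eq_mul] at this
    exact this.symm
  have hh0 : h z₀ ≠ 0 := by rwa [hh, dslope_same]
  have hev : ∀ᶠ z in 𝓝 z₀, h z / h z₀ ∈ Complex.slitPlane := by
    have hc : ContinuousAt (fun z => h z / h z₀) z₀ := (hhc.div_const _).continuousAt
    refine hc.eventually (Complex.isOpen_slitPlane.mem_nhds ?_)
    change h z₀ / h z₀ ∈ Complex.slitPlane
    rw [div_self hh0]
    exact Complex.one_mem_slitPlane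
  obtain ⟨r, hr, hball⟩ := Metric.eventually_nhds_iff_ball.1 hev
  have hhne : ∀ z ∈ Metric.ball z₀ r, h z ≠ 0 := fun z hz h2 =>
    Complex.slitPlane_ne_zero (hball z hz) (by rw [h2, zero_div])
  have hPne : ∀ z ∈ Metric.ball z₀ r \ {z₀}, P z ≠ 0 := fun z hz => by
    rw [hPh]
    exact mul_ne_zero (sub_ne_zero.2 hz.2) (hhne z hz.1)
  obtain ⟨τ, hτ0, hτ1, hτ⟩ : ∃ τ : ℝ, 0 < τ ∧ τ < 1 ∧
      (AffineMap.lineMap p z₀ τ : ℂ) ∈ Metric.ball z₀ r := by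
    have hc : Continuous fun t : ℝ => (AffineMap.lineMap p z₀ t : ℂ) :=
      AffineMap.lineMap_continuous
    have hm : ∀ᶠ t : ℝ in 𝓝 1, (AffineMap.lineMap p z₀ t : ℂ) ∈ Metric.ball z₀ r :=
      hc.continuousAt.eventually (Metric.isOpen_ball.mem_nhds (by simpa using hr))
    have hI : ∀ᶠ t : ℝ in 𝓝[<] 1, t ∈ Set.Ioo (0 : ℝ) 1 := Ioo_mem_nhdsLT zero_lt_one
    obtain ⟨τ, h2, h3⟩ := ((hm.filter_mono nhdsWithin_le_nhds).and hI).exists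
    exact ⟨τ, h3.1, h3.2, h2⟩
  set q : ℂ := AffineMap.lineMap p z₀ τ with hq
  have hPq : P q ≠ 0 := hseg τ hτ0.le hτ1
  have hqz : q ≠ z₀ := fun h2 => hPq (h2 ▸ h0)
  have hqmem : q ∈ Metric.ball z₀ r \ {z₀} := ⟨hτ, hqz⟩
  let γ : Path p q :=
    { toFun := fun t => AffineMap.lineMap p z₀ ((t : ℝ) * τ)
      continuous_toFun := AffineMap.lineMap_continuous.comp (by fun_prop)
      source' := by simp
      target' := by simp [hq] }
  obtain ⟨g, hg⟩ := hf.exists_continuesTo hk hP γ fun t =>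
    hseg _ (mul_nonneg t.2.1 hτ0.le) (lt_of_le_of_lt (mul_le_of_le_one_left hτ0.le t.2.2) hτ1)
  have hgb := hf.continuesTo hk hP hg
  refine ⟨r, hr, q, hqmem, g, ⟨γ, hg⟩, fun q' δ hδ =>
    hgb.exists_continuesTo hk hP δ fun t => hPne _ (hδ t), ?_⟩
  let ω : Path q q :=
    { toFun := fun t => z₀ + (q - z₀) * Complex.exp (2 * Real.pi * Complex.I * (t : ℝ))
      continuous_toFun := by fun_prop
      source' := by simp
      target' := by simp [Complex.exp_two_pi_mul_I] }
  have hωapp : ∀ t, ω t = z₀ + (q - z₀) * Complex.exp (2 * Real.pi * Complex.I * (t : ℝ)) :=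
    fun t => rfl
  have hω : ∀ t, ω t ∈ Metric.ball z₀ r \ {z₀} := by
    intro t
    have hnorm : ‖ω t - z₀‖ = ‖q - z₀‖ := by
      rw [hωapp, add_sub_cancel_left, norm_mul]
      have : 2 * (Real.pi : ℂ) * Complex.I * (t : ℝ) = ((2 * Real.pi * (t : ℝ) : ℝ) : ℂ) * Complex.I := by
        push_cast
        ring
      rw [this, Complex.norm_exp_ofReal_mul_I, mul_one]
    constructor
    · rw [mem_ball_iff_norm, hnorm, ← mem_ball_iff_norm]
      exact hτ
    · intro h2
      rw [Set.mem_singleton_iff] at h2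
      rw [h2, sub_self, norm_zero] at hnorm
      exact hqz (sub_eq_zero.1 (norm_eq_zero.1 hnorm.symm))
  set w₀ : ℂ := g q - k q with hw₀
  have hw₀sq : w₀ ^ 2 = P q := hgb.2.self_of_nhds
  set H : ℂ → ℂ := fun z => (h z / h z₀) ^ (2⁻¹ : ℂ) with hH
  have hHsq : ∀ z, H z ^ 2 = h z / h z₀ := fun z => Complex.cpow_ofNat_inv_pow _ _
  have hHq : H q ≠ 0 := fun h2 => by
    have := hHsq q
    rw [h2, zero_pow two_ne_zero] at this
    exact Complex.slitPlane_ne_zero (hball q hτ) this.symm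
  -- One turn multiplies `z - z₀` by `e^{2πit}`, so its root gains `e^{πit}`, which is `-1` at the
  -- end.
  let w : unitInterval → ℂ := fun t =>
    w₀ / H q * Complex.exp (Real.pi * Complex.I * (t : ℝ)) * H (ω t)
  have hwc : Continuous w := by
    refine Continuous.mul (by fun_prop) ?_
    rw [continuous_iff_continuousAt]
    intro t
    refine ContinuousAt.cpow ?_ continuousAt_const (hball _ (hω t).1)
    exact ((hhc.comp ω.continuous).div_const _).continuousAt
  have hwsq : ∀ t, w t ^ 2 = P (ω t) := by
    intro t
    have hexp : Complex.exp (Real.pi * Complex.I * (t : ℝ)) ^ 2 =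
        Complex.exp (2 * Real.pi * Complex.I * (t : ℝ)) := by
      rw [← Complex.exp_nat_mul]
      congr 1
      push_cast
      ring
    have hne := hhne q hτ
    simp only [w]
    rw [mul_pow, mul_pow, div_pow, hHsq, hHsq, hexp, hw₀sq, hPh q, hPh (ω t), hωapp t,
      add_sub_cancel_left]
    field_simp
  have hw0 : w 0 = g q - k q := by
    simp only [w, ω.source]
    simp [div_mul_cancel₀ _ hHq, hw₀]
  have hw1 : w 1 = -w₀ := by
    simp only [w, ω.target]
    simp only [Set.Icc.coe_one, Complex.ofReal_one, mul_one, Complex.exp_pi_mul_I]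
    field_simp
  refine ⟨ω, hω, _, hgb.continuesTo_sqrtBranch hk hP ω (fun t => hPne _ (hω t)) hwc hwsq hw0, ?_⟩
  intro heq
  have h2 := heq.eq_of_nhds
  rw [sqrtBranch_self hPq, hw1] at h2
  have h3 : w₀ = 0 := by linear_combination (-1 / 2 : ℂ) * h2 + (1 / 2 : ℂ) * hw₀
  rw [h3, zero_pow two_ne_zero] at hw₀sq
  exact hPq hw₀sq.symm

end SquareRoots

/-! ### Branch points of the extended gain symbol. -/

section GainSymbol

/-- The polynomial part of the extended symbol. -/
def symbolPoly (n : ℕ) (a : ℝ) (z : ℂ) : ℂ := -|a| * (-Complex.I * z) ^ (2 * n)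

/-- The radicand of the extended symbol. -/
def symbolRadicand (n : ℕ) (a s : ℝ) (z : ℂ) : ℂ := (a : ℂ) ^ 2 * z ^ (4 * n) + (s : ℂ) ^ 2

variable {n : ℕ} {a s : ℝ}

lemma analyticAt_symbolPoly (z : ℂ) : AnalyticAt ℂ (symbolPoly n a) z := by
  unfold symbolPoly
  fun_prop

lemma analyticAt_symbolRadicand (z : ℂ) : AnalyticAt ℂ (symbolRadicand n a s) z := by
  unfold symbolRadicand
  fun_prop

lemma symbolPoly_I_mul (lam : ℝ) :
    symbolPoly n a (Complex.I * lam) = ((-|a| * lam ^ (2 * n) : ℝ) : ℂ) := by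
  unfold symbolPoly
  rw [← mul_assoc, neg_mul Complex.I, Complex.I_mul_I, neg_neg, one_mul]
  push_cast
  rfl

lemma symbolRadicand_I_mul (lam : ℝ) :
    symbolRadicand n a s (Complex.I * lam) = ((a ^ 2 * lam ^ (4 * n) + s ^ 2 : ℝ) : ℂ) := by
  unfold symbolRadicand
  rw [mul_pow, pow_mul Complex.I, Complex.I_pow_four, one_pow, one_mul]
  push_cast
  rfl

lemma symbolRadicand_real_nonneg (lam : ℝ) : 0 ≤ a ^ 2 * lam ^ (4 * n) + s ^ 2 := by
  have : 0 ≤ lam ^ (4 * n) := by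
    rw [show 4 * n = 2 * (2 * n) by ring, pow_mul]
    positivity
  positivity

lemma deriv_symbolRadicand_ne_zero {z : ℂ} (hn : 1 ≤ n) (ha : a ≠ 0) (hs : 0 < s)
    (hz : symbolRadicand n a s z = 0) : deriv (symbolRadicand n a s) z ≠ 0 := by
  have hz0 : z ≠ 0 := by
    rintro rfl
    unfold symbolRadicand at hz
    rw [zero_pow (by omega), mul_zero, zero_add] at hz
    exact pow_ne_zero 2 (Complex.ofReal_ne_zero.2 hs.ne') hz
  have hd : HasDerivAt (symbolRadicand n a s) ((a : ℂ) ^ 2 * ((4 * n : ℕ) * z ^ (4 * n - 1))) z :=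
    ((hasDerivAt_pow (4 * n) z).const_mul _).add_const _
  rw [hd.deriv]
  refine mul_ne_zero (pow_ne_zero 2 (Complex.ofReal_ne_zero.2 ha))
    (mul_ne_zero ?_ (pow_ne_zero _ hz0))
  exact_mod_cast (by omega : 4 * n ≠ 0)

/-- Germs extending the symbol are branches of the algebraic function `-|a|(-iz)^{2n} + √…`. -/
lemma IsExtensionGerm.isSqrtBranch {lam₀ : ℝ} {f : ℂ → ℂ}
    (h : IsExtensionGerm (fun lam : ℝ =>
      ((-|a| * lam ^ (2 * n) + √(a ^ 2 * lam ^ (4 * n) + s ^ 2) : ℝ) : ℂ)) lam₀ f) :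
    IsSqrtBranch (symbolPoly n a) (symbolRadicand n a s) f (Complex.I * lam₀) := by
  refine ⟨h.1, ?_⟩
  have han : AnalyticAt ℂ (fun z => (f z - symbolPoly n a z) ^ 2 - symbolRadicand n a s z)
      (Complex.I * lam₀) :=
    ((h.1.sub (analyticAt_symbolPoly _)).pow 2).sub (analyticAt_symbolRadicand _)
  have htend : Filter.Tendsto (fun lam : ℝ => Complex.I * (lam : ℂ)) (𝓝[≠] lam₀)
      (𝓝[≠] (Complex.I * lam₀)) := by
    refine tendsto_nhdsWithin_iff.2 ⟨?_, ?_⟩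
    · exact ((by fun_prop : Continuous fun lam : ℝ => Complex.I * (lam : ℂ)).tendsto lam₀).mono_left
        nhdsWithin_le_nhds
    · filter_upwards [self_mem_nhdsWithin] with lam hlam
      intro h1
      exact hlam (Complex.ofReal_injective (mul_left_cancel₀ Complex.I_ne_zero h1))
  have hev : ∀ᶠ lam : ℝ in 𝓝[≠] lam₀, (f (Complex.I * lam) - symbolPoly n a (Complex.I * lam)) ^ 2
      - symbolRadicand n a s (Complex.I * lam) = 0 := by
    filter_upwards [h.2.filter_mono nhdsWithin_le_nhds] with lam hlam
    rw [hlam, symbolPoly_I_mul, symbolRadicand_I_mul, ← Complex.ofReal_sub, add_sub_cancel_left,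
      ← Complex.ofReal_pow, Real.sq_sqrt (symbolRadicand_real_nonneg lam), sub_self]
  -- The relation is known only on the imaginary axis; since the base point is an accumulation point
  -- of it, the identity theorem applies.
  have := han.frequently_zero_iff_eventually_zero.1 (htend.frequently hev.frequently)
  filter_upwards [this] with z hz
  exact sub_eq_zero.1 hz

lemma isExtensionGerm_zero (hn : 1 ≤ n) (hs : 0 < s) :
    IsExtensionGerm (fun lam : ℝ =>
      ((-|a| * lam ^ (2 * n) + √(a ^ 2 * lam ^ (4 * n) + s ^ 2) : ℝ) : ℂ)) 0
      (fun z => symbolPoly n a z + symbolRadicand n a s z ^ (2⁻¹ : ℂ)) := by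
  constructor
  · refine (analyticAt_symbolPoly _).add
      ((analyticAt_symbolRadicand _).cpow analyticAt_const ?_)
    rw [symbolRadicand_I_mul, zero_pow (by omega), mul_zero, zero_add, Complex.ofReal_mem_slitPlane]
    positivity
  · refine Filter.Eventually.of_forall fun lam => ?_
    beta_reduce
    rw [symbolPoly_I_mul, symbolRadicand_I_mul, Real.sqrt_eq_rpow,
      Complex.ofReal_add (-|a| * lam ^ (2 * n)), Complex.ofReal_cpow (symbolRadicand_real_nonneg lam)]
    norm_num

/-- `4nφ` is an odd multiple of `π` not exceeding `2πn`, hence at most `2πn - π`; so `φ ≤ π/2 -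
π/(4n)`. -/
lemma sin_le_cos_of_cos_eq_neg_one (hn : 1 ≤ n) {φ : ℝ} (h0 : 0 ≤ φ) (h1 : φ ≤ Real.pi / 2)
    (h : Real.cos (4 * n * φ) = -1) : Real.sin (Real.pi / (4 * n)) ≤ Real.cos φ := by
  have hn' : (1 : ℝ) ≤ n := by exact_mod_cast hn
  have hπ := Real.pi_pos
  by_contra! hlt
  rw [← Real.cos_pi_div_two_sub] at hlt
  have hδ : Real.pi / (4 * n) ≤ Real.pi / 2 := by gcongr; linarith
  have hφ : Real.pi / 2 - Real.pi / (4 * n) < φ := by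
    by_contra! hle
    exact absurd hlt (not_lt.2 (Real.cos_le_cos_of_nonneg_of_le_pi h0 (by
      have : 0 < Real.pi / (4 * n) := by positivity
      linarith) hle))
  have h4 : Real.cos (n * (2 * Real.pi) - 4 * n * φ) = -1 := by
    rw [Real.cos_nat_mul_two_pi_sub, h]
  have h5 : n * (2 * Real.pi) - 4 * n * φ < Real.pi := by
    have h6 : 4 * n * (Real.pi / 2 - Real.pi / (4 * n)) < 4 * n * φ := by gcongr
    have h7 : 4 * n * (Real.pi / 2 - Real.pi / (4 * n)) = n * (2 * Real.pi) - Real.pi := by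
      field_simp
      ring
    linarith
  have h8 : 0 ≤ n * (2 * Real.pi) - 4 * n * φ := by nlinarith
  have h9 := Real.cos_lt_cos_of_nonneg_of_le_pi h8 le_rfl h5
  rw [h4, Real.cos_pi] at h9
  exact lt_irrefl _ h9

/-- Moduli give `‖z‖ = ρ`, and the symmetry `z ↦ -z` allows `Re z ≥ 0`. What remains is a bound on
`cos (arg z)` with `|arg z| ≤ π/2`. -/
lemma abs_re_ge_of_pow_eq (hn : 1 ≤ n) {ρ : ℝ} (hρ : 0 < ρ) {z : ℂ}
    (hz : z ^ (4 * n) = -(ρ : ℂ) ^ (4 * n)) : Real.sin (Real.pi / (4 * n)) * ρ ≤ |z.re| := by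
  have hnorm : ‖z‖ = ρ := by
    have h1 := congrArg norm hz
    rw [norm_neg, norm_pow, norm_pow, Complex.norm_real, Real.norm_of_nonneg hρ.le] at h1
    exact (pow_left_inj₀ (norm_nonneg _) hρ.le (by omega)).1 h1
  wlog hre : 0 ≤ z.re generalizing z
  · have := this (z := -z) (by rw [Even.neg_pow ⟨2 * n, by ring⟩, hz]) (by rw [norm_neg, hnorm])
      (by simpa using (not_le.1 hre).le)
    rwa [Complex.neg_re, abs_neg] at this
  have hcos : Real.cos (4 * n * z.arg) = -1 := by
    have h1 := hz
    rw [← Complex.norm_mul_exp_arg_mul_I z, hnorm, mul_pow, ← Complex.exp_nat_mul] at h1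
    have hρ' : (ρ : ℂ) ^ (4 * n) ≠ 0 := pow_ne_zero _ (Complex.ofReal_ne_zero.2 hρ.ne')
    have h2 : Complex.exp ((4 * n * z.arg : ℝ) * Complex.I) = -1 := by
      refine mul_left_cancel₀ hρ' (Eq.trans ?_ (h1.trans (by ring)))
      congr 2
      push_cast
      ring
    have h3 := congrArg Complex.re h2
    rwa [Complex.exp_ofReal_mul_I_re, Complex.neg_re, Complex.one_re] at h3
  have hz0 : z ≠ 0 := fun h => hρ.ne' (by rw [← hnorm, h, norm_zero])
  have h1 : Real.sin (Real.pi / (4 * n)) ≤ Real.cos |z.arg| := by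
    refine sin_le_cos_of_cos_eq_neg_one hn (abs_nonneg _)
      (Complex.abs_arg_le_pi_div_two_iff.2 hre) ?_
    rcases abs_choice z.arg with h | h
    · rw [h, hcos]
    · rw [h, mul_neg, Real.cos_neg, hcos]
  rw [Real.cos_abs, Complex.cos_arg hz0, hnorm, le_div_iff₀ hρ] at h1
  rwa [abs_of_nonneg hre]

/-- The zero of the radicand that is closest to the imaginary axis. -/
lemma exists_pow_eq_re_eq (hn : 1 ≤ n) (ρ : ℝ) :
    ∃ z : ℂ, z ^ (4 * n) = -(ρ : ℂ) ^ (4 * n) ∧ z.re = Real.sin (Real.pi / (4 * n)) * ρ := by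
  have hn' : (n : ℂ) ≠ 0 := by exact_mod_cast (by omega : n ≠ 0)
  refine ⟨ρ * (Complex.I * Complex.exp ((-(Real.pi / (4 * n)) : ℝ) * Complex.I)), ?_, ?_⟩
  · rw [mul_pow, mul_pow, pow_mul Complex.I, Complex.I_pow_four, one_pow, one_mul,
      ← Complex.exp_nat_mul]
    have : ((4 * n : ℕ) : ℂ) * ((-(Real.pi / (4 * n)) : ℝ) * Complex.I) = -(Real.pi * Complex.I) := by
      push_cast
      field_simp
    rw [this, Complex.exp_neg, Complex.exp_pi_mul_I]
    norm_num
  · rw [Complex.re_ofReal_mul, Complex.I_mul_re, Complex.exp_ofReal_mul_I_im, Real.sin_neg]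
    ring

theorem isLeast_abs_re_extensionBranchPoints (hn : 1 ≤ n) (ha : a ≠ 0) (hs : 0 < s) {ρ : ℝ}
    (hρ : 0 < ρ) (hρn : ρ ^ (2 * n) = s / |a|) :
    IsLeast ((fun z : ℂ => |z.re|) '' extensionBranchPoints (fun lam : ℝ =>
      ((-|a| * lam ^ (2 * n) + √(a ^ 2 * lam ^ (4 * n) + s ^ 2) : ℝ) : ℂ)))
      (Real.sin (Real.pi / (4 * n)) * ρ) := by
  have hroot : ∀ z, symbolRadicand n a s z = 0 ↔ z ^ (4 * n) = -(ρ : ℂ) ^ (4 * n) := by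
    intro z
    have h1 : a ^ 2 * ρ ^ (4 * n) = s ^ 2 := by
      rw [show 4 * n = 2 * n * 2 by ring, pow_mul, hρn, div_pow, sq_abs]
      field_simp
    have h2 : (a : ℂ) ^ 2 * (ρ : ℂ) ^ (4 * n) = (s : ℂ) ^ 2 := by exact_mod_cast h1
    have ha2 : (a : ℂ) ^ 2 ≠ 0 := pow_ne_zero 2 (Complex.ofReal_ne_zero.2 ha)
    rw [symbolRadicand, ← h2, ← mul_add, mul_eq_zero, or_iff_right ha2, eq_neg_iff_add_eq_zero]
  constructor
  · obtain ⟨z₀, hz₀, hre⟩ := exists_pow_eq_re_eq hn ρ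
    have hsin : 0 ≤ Real.sin (Real.pi / (4 * n)) := by
      refine Real.sin_nonneg_of_nonneg_of_le_pi (by positivity) ?_
      have hn' : (1 : ℝ) ≤ n := by exact_mod_cast hn
      exact div_le_self Real.pi_pos.le (by linarith)
    -- From base point 0 the radicand at `t z₀` is `s² (1 - t^(4n))`, so the segment meets no zero
    -- before its end.
    refine ⟨z₀, ⟨0, _, isExtensionGerm_zero hn hs, ?_⟩, ?_⟩
    · have hb := (isExtensionGerm_zero (a := a) hn hs).isSqrtBranch
      have h0 := (hroot z₀).2 hz₀
      refine isBranchPoint_of_simple_zero analyticAt_symbolPoly analyticAt_symbolRadicand hb h0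
        (deriv_symbolRadicand_ne_zero hn ha hs h0) fun t ht0 ht1 h1 => ?_
      rw [hroot, Complex.ofReal_zero, mul_zero, AffineMap.lineMap_apply_module, smul_zero, zero_add,
        Complex.real_smul, mul_pow, hz₀] at h1
      have hρ' : (ρ : ℂ) ^ (4 * n) ≠ 0 := pow_ne_zero _ (Complex.ofReal_ne_zero.2 hρ.ne')
      have h2 : (t : ℂ) ^ (4 * n) = 1 := by
        refine mul_right_cancel₀ (neg_ne_zero.2 hρ') (h1.trans (one_mul _).symm)
      have h3 : t ^ (4 * n) = 1 := by exact_mod_cast h2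
      exact (pow_lt_one₀ ht0 ht1 (by omega)).ne h3
    · simp only [hre]
      exact abs_of_nonneg (mul_nonneg hsin hρ.le)
  · rintro _ ⟨z, ⟨lam₀, f, hf, hz⟩, rfl⟩
    have h0 := hz.radicand_eq_zero analyticAt_symbolPoly analyticAt_symbolRadicand
      (fun z => deriv_symbolRadicand_ne_zero hn ha hs) hf.isSqrtBranch
    exact abs_re_ge_of_pow_eq hn hρ ((hroot z).1 h0)

end GainSymbol

end

/-! ### The main theorem. -/

theorem theorem2 (n : ℕ) (hn : 1 ≤ n) (a σw σv : ℝ)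
    (ha_odd : Odd n → 0 < a) (ha_even : Even n → a < 0) (hσw : 0 < σw) (hσv : 0 < σv) :
    (∃! L, (monomialPlant n a σw σv).IsKalmanGain L) ∧
    ∀ L, (monomialPlant n a σw σv).IsKalmanGain L →
      IsFourierSymbol L (fun lam : ℝ =>
        ((-|a| * lam ^ (2 * n) + √(a ^ 2 * lam ^ (4 * n) + σw ^ 2 / σv ^ 2) : ℝ) : ℂ)) ∧
      HasDecayRate L
        (Real.sin (Real.pi / (4 * n)) * (σw / (|a| * σv)) ^ (1 / (2 * n) : ℝ)) := by
  obtain ⟨L₀, hL₀, hsymb⟩ := exists_forall_isKalmanGain_iff_eq ha_odd ha_even hσw hσv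
  have ha := coeff_ne_zero ha_odd ha_even
  have hn' : (1 : ℝ) ≤ n := by exact_mod_cast hn
  have hquot : 0 < σw / (|a| * σv) := div_pos hσw (mul_pos (abs_pos.2 ha) hσv)
  refine ⟨⟨L₀, (hL₀ L₀).2 rfl, fun L hL => (hL₀ L).1 hL⟩, fun L hL => ?_⟩
  rw [(hL₀ L).1 hL]
  refine ⟨hsymb, mul_pos (Real.sin_pos_of_pos_of_lt_pi (by positivity) ?_)
    (Real.rpow_pos_of_pos hquot _), _, hsymb, ?_⟩
  · exact div_lt_self Real.pi_pos (by linarith)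
  · have hρn : ((σw / (|a| * σv)) ^ (1 / (2 * n) : ℝ)) ^ (2 * n) = (σw / σv) / |a| := by
      rw [← Real.rpow_natCast, ← Real.rpow_mul hquot.le]
      push_cast
      rw [one_div_mul_cancel (by positivity), Real.rpow_one, div_div, mul_comm]
    have := isLeast_abs_re_extensionBranchPoints hn ha (div_pos hσw hσv)
      (Real.rpow_pos_of_pos hquot _) hρn
    simpa only [div_pow, gainSymbol] using this
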